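/- Let $A$ be an alphabet. A \emph{set partition} is a finite word $p = p_1p_2\cdots p_n$ of (possibly repeated) letters of $A$; $|p| = n$ is its length and $N(p)$ is the number of distinct letters occurring in it. It is \emph{sorted} if all occurrences of each letter are consecutive. Two set partitions $p = p_1\cdots p_n$ and $q = q_1\cdots q_n$ are \emph{equivalent} if $q = f(p_1)\cdots f(p_n)$ for some bijection $f : A \to A$. Fix distinct letters $a, b \in A$. The map $\phi_{aba}$ sends $p$ through an initially empty stack: at each step, if pushing the leftmost remaining input letter leaves a stack with no (not necessarily contiguous) subsequence equivalent to $aba$, that letter is pushed; otherwise the top of the stack is popped and appended to the output; when the input is exhausted, the stack is popped from top to bottom to the output. Then $\phi_{aba}(p)$ is the output word. Let $N \ge 3$ be an integer and suppose that $A$ has at least $N$ letters. Then the number of equivalence classes of set partitions $p$ with $N(p) = N$ and $|p| = 2N+1$ such that $\phi_{aba}^{N-1}(p)$ is not sorted is exactly $$\binom{N+1}{2} + 2\binom{N}{2}.$$ -/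

import Mathlib

namespace StackSort

universe u

variable {A : Type u}

/-- A set partition is a word `p = p₁ p₂ ⋯ pₙ` over the alphabet `A`. Two of them are equivalent if
a bijection of the alphabet carries one to the other. -/
def Equivalent (p q : List A) : Prop :=
  ∃ f : Equiv.Perm A, q = p.map f

/-- Equivalence of set partitions as a setoid; its classes are the set partitions up to
equivalence. -/
def equivSetoid (A : Type u) : Setoid (List A) where
  r := Equivalent
  iseqv :=
    { refl := fun p => ⟨Equiv.refl A, by simp⟩
      symm := by
        rintro p q ⟨f, rfl⟩
        exact ⟨f.symm, by simp⟩
      trans := by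
        rintro p q r ⟨f, rfl⟩ ⟨g, rfl⟩
        exact ⟨f.trans g, by simp⟩ }

/-- `numLetters p` is `N(p)`, the number of distinct letters that occur in `p`. -/
noncomputable def numLetters (p : List A) : ℕ :=
  {a : A | a ∈ p}.ncard

/-- All occurrences of the same letter are consecutive. -/
def IsSorted (p : List A) : Prop :=
  ∀ i j k : ℕ, ∀ (hij : i < j) (hjk : j < k) (hk : k < p.length),
    p[i] = p[k] → p[j] = p[i]

/-- The stack `s` (head of the list = top of the stack) has no subsequence equivalent to `σ`. -/
def Avoids (σ s : List A) : Prop :=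
  ∀ t : List A, t.Sublist s → ¬ Equivalent t σ

open Classical in
/-- `run σ input stack` is the word output by the machine from the given remaining input and
stack (head = top) onwards. The next letter is pushed if the stack then still avoids `σ` (or if the
stack is empty); otherwise the top of the stack is popped to the end of the output. Once the input
is exhausted, the stack is popped from top to bottom. -/
noncomputable def run (σ : List A) : List A → List A → List A
  | [], s => s
  | x :: xs, [] => run σ xs [x]
  | x :: xs, y :: s =>
      if Avoids σ (x :: y :: s) then run σ xs (x :: y :: s)
      else y :: run σ (x :: xs) s
termination_by input s => 2 * input.length + s.length

/-- The stack-sorting map `φ_σ`. -/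
noncomputable def phi (σ p : List A) : List A :=
  run σ p []

end StackSort

/-!
A pass sends `x w₁ x w₂ ⋯ x wₘ`, where `x` does not occur in the `wᵢ`, to `φ(w₁) ⋯ φ(wₘ) xᵐ`. Call
a letter clumped if its occurrences are consecutive. A clumped letter stays clumped, and a pass
clumps the first letter that is not clumped yet. A word with `N` letters that is unsorted after
`N - 1` passes must therefore start with no clumped letter and gain exactly one in each pass. In
particular every letter occurs at least twice in it, so for length `2N + 1` exactly one letter
occurs three times.

Deleting the first letter `x` after one pass leaves a word of the same extremal kind. If all letters
of such a word occur twice, it is a square `v v`; if one of them occurs three times, it is `v v`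
with one letter doubled in place. Reading the first pass backwards, `x` occurs three times in the
first case and twice in the second, and the words `wᵢ` are cut out of `v` by two indices `j ≤ k`.
This gives `N(N+1)/2` classes when `x` is the letter occurring three times, and `N(N-1)/2` classes
for each of the two factors `v` in which a letter may be doubled. Conversely, doubling a letter in
place commutes with passes, so it suffices to follow the word `v v x`, which is still unsorted after
`N - 2` passes.
-/

namespace StackSort

universe u

variable {A : Type u}

/-! ### Clumped letters -/

/-- All occurrences of the letter `z` in the word `p` are consecutive. -/
def Clumped (z : A) (p : List A) : Prop :=
  ∀ y, [z, y, z].Sublist p → y = z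

theorem Clumped.sublist {z : A} {p q : List A} (h : Clumped z p) (hq : q.Sublist p) :
    Clumped z q :=
  fun y hy => h y (hy.trans hq)

theorem Clumped.reverse {z : A} {p : List A} (h : Clumped z p) : Clumped z p.reverse :=
  fun y hy => h y (by simpa using hy.reverse)

theorem clumped_of_notMem {z : A} {p : List A} (h : z ∉ p) : Clumped z p :=
  fun _ hy => absurd (hy.subset List.mem_cons_self) h

theorem clumped_of_forall_eq {z : A} {p : List A} (h : ∀ y ∈ p, y = z) : Clumped z p :=
  fun y hy => h y (hy.subset (by simp))

theorem Clumped.append_left {z : A} {l r : List A} (hr : Clumped z r) (hl : z ∉ l) :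
    Clumped z (l ++ r) := by
  intro y hy
  obtain ⟨l₁, l₂, hsplit, h₁, h₂⟩ := List.sublist_append_iff.1 hy
  cases l₁ with
  | nil => exact hr y (by rwa [hsplit, List.nil_append])
  | cons c l₁ =>
    obtain ⟨rfl, -⟩ := List.cons.inj hsplit
    exact absurd (h₁.subset List.mem_cons_self) hl

theorem Clumped.append_right {z : A} {l r : List A} (hl : Clumped z l) (hr : z ∉ r) :
    Clumped z (l ++ r) := by
  simpa using (hl.reverse.append_left (l := r.reverse) (by simpa using hr)).reverse

theorem Clumped.cons {z x : A} {r : List A} (hr : Clumped z r) (hx : z ≠ x) :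
    Clumped z (x :: r) :=
  hr.append_left (l := [x]) (by simpa using hx)

theorem sublist_append_cons_of_mem {z y : A} {l r : List A} (hl : z ∈ l) (hr : z ∈ r) :
    [z, y, z].Sublist (l ++ y :: r) :=
  (List.singleton_sublist.2 hl).append ((List.singleton_sublist.2 hr).cons_cons y)

theorem clumped_append_replicate {x : A} {l : List A} (hl : x ∉ l) (k : ℕ) :
    Clumped x (l ++ List.replicate k x) :=
  (clumped_of_forall_eq fun _ hy => List.eq_of_mem_replicate hy).append_left hl

theorem Clumped.exists_eq_replicate_append {x : A} {w : List A} (h : Clumped x (x :: w)) :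
    ∃ m w', w = List.replicate m x ++ w' ∧ x ∉ w' := by
  induction w with
  | nil => exact ⟨0, [], rfl, List.not_mem_nil⟩
  | cons y w ih =>
    by_cases hyx : y = x
    · subst hyx
      obtain ⟨m, w', rfl, hw'⟩ := ih (h.sublist (List.sublist_cons_self y _))
      exact ⟨m + 1, w', rfl, hw'⟩
    · refine ⟨0, y :: w, rfl, fun hx => hyx (h y ?_)⟩
      have hxw : x ∈ w := (List.mem_cons.1 hx).resolve_left (Ne.symm hyx)
      exact ((List.singleton_sublist.2 hxw).cons_cons y).cons_cons x

theorem isSorted_iff_forall_clumped {p : List A} : IsSorted p ↔ ∀ z, Clumped z p := by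
  constructor
  · intro h z y hy
    obtain ⟨f, hf⟩ := List.sublist_iff_exists_fin_orderEmbedding_get_eq.1 hy
    have hy₀ : z = p[f 0] := hf 0
    have hy₁ : y = p[f 1] := hf 1
    have hy₂ : z = p[f 2] := hf 2
    rw [hy₁, hy₀]
    exact h (f 0) (f 1) (f 2) (f.strictMono Nat.zero_lt_one)
      (f.strictMono (Nat.lt_succ_self 1)) (f 2).2 (hy₀.symm.trans hy₂)
  · intro h i j k hij hjk hk hik
    apply h
    rw [List.sublist_iff_exists_fin_orderEmbedding_get_eq]
    refine ⟨OrderEmbedding.ofStrictMono ![⟨i, by omega⟩, ⟨j, by omega⟩, ⟨k, hk⟩] ?_, ?_⟩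
    · rw [Fin.strictMono_iff_lt_succ]
      intro t
      fin_cases t <;> simpa
    · intro t
      fin_cases t <;> simp [hik]

theorem IsSorted.sublist {p q : List A} (h : IsSorted p) (hq : q.Sublist p) : IsSorted q :=
  isSorted_iff_forall_clumped.2 fun z => (isSorted_iff_forall_clumped.1 h z).sublist hq

theorem isSorted_append_of_disjoint {s t : List A} (hst : s.Disjoint t) :
    IsSorted (s ++ t) ↔ IsSorted s ∧ IsSorted t := by
  refine ⟨fun h => ⟨h.sublist (by simp), h.sublist (by simp)⟩, fun ⟨hs, ht⟩ => ?_⟩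
  rw [isSorted_iff_forall_clumped] at hs ht ⊢
  intro z
  by_cases hz : z ∈ s
  · exact (hs z).append_right (hst hz)
  · exact (ht z).append_left hz

theorem isSorted_replicate (k : ℕ) (x : A) : IsSorted (List.replicate k x) :=
  fun _ _ _ _ _ _ _ => by simp

theorem exists_perm_map_eq {l l' : List A} (h : l.Nodup) (h' : l'.Nodup)
    (hlen : l.length = l'.length) : ∃ f : Equiv.Perm A, l.map f = l' := by
  obtain ⟨f, hf⟩ := (Equiv.Perm.isMultiplyPretransitive A l.length).exists_smul_eq
    ⟨l.get, List.nodup_iff_injective_get.1 h⟩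
    ⟨fun i => l'.get (i.cast hlen),
      (List.nodup_iff_injective_get.1 h').comp (Fin.cast_injective hlen)⟩
  refine ⟨f, List.ext_get (by simpa using hlen) fun n h₁ h₂ => ?_⟩
  simpa using DFunLike.congr_fun hf ⟨n, by simpa using h₁⟩

theorem equivalent_aba_iff {a b : A} (hab : a ≠ b) {t : List A} :
    Equivalent t [a, b, a] ↔ ∃ z y, y ≠ z ∧ t = [z, y, z] := by
  constructor
  · rintro ⟨f, hf⟩
    have hlen : t.length = 3 := by simpa using (congrArg List.length hf).symm
    obtain ⟨z, y, z', rfl⟩ := List.length_eq_three.1 hlen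
    obtain ⟨rfl, rfl, hz⟩ : a = f z ∧ b = f y ∧ a = f z' := by simpa using hf
    exact ⟨z, y, fun hyz => hab (hyz ▸ rfl), by rw [f.injective hz]⟩
  · rintro ⟨z, y, hyz, rfl⟩
    obtain ⟨f, hf⟩ := exists_perm_map_eq (l := [z, y]) (l' := [a, b])
      (by simpa using hyz.symm) (by simpa using hab) rfl
    obtain ⟨rfl, rfl⟩ : f z = a ∧ f y = b := by simpa using hf
    exact ⟨f, rfl⟩

theorem avoids_aba_iff {a b : A} (hab : a ≠ b) {s : List A} :
    Avoids [a, b, a] s ↔ IsSorted s := by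
  rw [isSorted_iff_forall_clumped]
  constructor
  · intro h z y hy
    by_contra hne
    exact h _ hy ((equivalent_aba_iff hab).2 ⟨z, y, hne, rfl⟩)
  · intro h t ht hequiv
    obtain ⟨z, y, hne, rfl⟩ := (equivalent_aba_iff hab).1 hequiv
    exact hne (h z y ht)

@[elab_as_elim]
theorem splitOn_induction (x : A) {P : List A → Prop} (notMem : ∀ w, x ∉ w → P w)
    (append_cons : ∀ u v, x ∉ u → P v → P (u ++ x :: v)) (w : List A) : P w := by
  induction hn : w.length using Nat.strong_induction_on generalizing w with
  | _ n ih =>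
    by_cases hx : x ∈ w
    · obtain ⟨u, v, rfl, hu⟩ := List.eq_append_cons_of_mem hx
      exact append_cons u v hu (ih v.length (by simp [← hn]; omega) v rfl)
    · exact notMem w hx

/-! ### One pass -/

section SplitOn

variable [DecidableEq A]

theorem flatten_splitOn (x : A) (w : List A) :
    (w.splitOn x).flatten = w.filter (· ≠ x) := by
  induction w using splitOn_induction x with
  | notMem w hw =>
    rw [List.splitOn_eq_singleton hw, List.flatten_singleton, List.filter_eq_self.2]
    exact fun y hy => decide_eq_true (ne_of_mem_of_not_mem hy hw)
  | append_cons u v hu ih =>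
    rw [List.splitOn_append_cons_self_of_not_mem hu, List.flatten_cons, ih, List.filter_append,
      List.filter_eq_self.2 fun y hy => decide_eq_true (ne_of_mem_of_not_mem hy hu),
      List.filter_cons_of_neg (by simp)]

theorem length_splitOn (x : A) (w : List A) : (w.splitOn x).length = w.count x + 1 := by
  induction w using splitOn_induction x with
  | notMem w hw =>
    rw [List.splitOn_eq_singleton hw, List.length_singleton, List.count_eq_zero_of_not_mem hw]
  | append_cons u v hu ih =>
    rw [List.splitOn_append_cons_self_of_not_mem hu, List.length_cons, ih, List.count_append,
      List.count_cons_self, List.count_eq_zero_of_not_mem hu, Nat.zero_add]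

theorem sublist_of_mem_splitOn {x : A} {w b : List A} (hb : b ∈ w.splitOn x) : b.Sublist w := by
  have := List.sublist_flatten_of_mem hb
  rw [flatten_splitOn] at this
  exact this.trans List.filter_sublist

theorem splitOn_replicate_append {x : A} {w : List A} (hx : x ∉ w) (m : ℕ) :
    (List.replicate m x ++ w).splitOn x = List.replicate m [] ++ [w] := by
  induction m with
  | zero => exact List.splitOn_eq_singleton hx
  | succ m ih =>
    rw [List.replicate_succ, List.cons_append, List.splitOn_cons_eq_if_modifyHead, if_pos (by simp),
      ih, List.replicate_succ, List.cons_append]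

theorem splitOn_filter {C : A → Bool} {x : A} (hx : C x) (w : List A) :
    (w.filter C).splitOn x = (w.splitOn x).map (List.filter C) := by
  induction w using splitOn_induction x with
  | notMem w hw =>
    rw [List.splitOn_eq_singleton hw, List.map_singleton,
      List.splitOn_eq_singleton fun h => hw (List.mem_of_mem_filter h)]
  | append_cons u v hu ih =>
    rw [List.filter_append, List.filter_cons_of_pos hx,
      List.splitOn_append_cons_self_of_not_mem fun h => hu (List.mem_of_mem_filter h), ih,
      List.splitOn_append_cons_self_of_not_mem hu, List.map_cons]

end SplitOn

/-- One pass of the `aba`-avoiding stack, described recursively: the first letter `x` stays at the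
bottom of the stack, and each further `x` empties the stack above it, so the blocks between the
occurrences of `x` are processed independently before all the `x`s are output. -/
def abaSort [DecidableEq A] : List A → List A
  | [] => []
  | x :: w => (w.splitOn x).attach.flatMap (fun ⟨b, _⟩ => abaSort b) ++
      List.replicate (w.count x + 1) x
termination_by p => p.length
decreasing_by exact Nat.lt_succ_of_le (sublist_of_mem_splitOn ‹_›).length_le

/-- The output of a pass on `x :: w` without its final run of `x`s. -/
def peel [DecidableEq A] (x : A) (w : List A) : List A :=
  (w.splitOn x).flatMap abaSort

section Run

variable {a b : A}

theorem run_cons_of_isSorted (hab : a ≠ b) {x : A} {s : List A} (h : IsSorted (x :: s))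
    (w : List A) : run [a, b, a] (x :: w) s = run [a, b, a] w (x :: s) := by
  cases s with
  | nil => rw [run]
  | cons y s => rw [run, if_pos ((avoids_aba_iff hab).2 h)]

theorem run_cons_of_not_isSorted (hab : a ≠ b) {x y : A} {s : List A}
    (h : ¬IsSorted (x :: y :: s)) (w : List A) :
    run [a, b, a] (x :: w) (y :: s) = y :: run [a, b, a] (x :: w) s := by
  rw [run, if_neg (mt (avoids_aba_iff hab).1 h)]

-- The part `t` of the stack lies untouched until `w` is used up; by `hv` it then gets exposed.
theorem run_append_append (hab : a ≠ b) {t v : List A} (ht : IsSorted t)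
    (hv : ∀ s, s.Disjoint t → run [a, b, a] v (s ++ t) = s ++ run [a, b, a] v t)
    (w s : List A) (hw : w.Disjoint t) (hs : s.Disjoint t) :
    run [a, b, a] (w ++ v) (s ++ t) = run [a, b, a] w s ++ run [a, b, a] v t := by
  induction w generalizing s with
  | nil => rw [List.nil_append, hv s hs, run]
  | cons x w ihw =>
    rw [List.disjoint_cons_left] at hw
    induction s with
    | nil =>
      have hx : [x].Disjoint t := by simpa using hw.1
      have hx_sorted : IsSorted [x] := isSorted_replicate 1 x
      have hpush : IsSorted (x :: t) := (isSorted_append_of_disjoint hx).2 ⟨hx_sorted, ht⟩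
      rw [List.cons_append, List.nil_append, run_cons_of_isSorted hab hpush,
        run_cons_of_isSorted hab hx_sorted, ← ihw [x] hw.2 hx, List.singleton_append]
    | cons y s ihs =>
      have hxs : (x :: y :: s).Disjoint t := List.disjoint_cons_left.2 ⟨hw.1, hs⟩
      by_cases hpush : IsSorted (x :: y :: s)
      · have hpush' : IsSorted (x :: (y :: s ++ t)) :=
          (isSorted_append_of_disjoint hxs).2 ⟨hpush, ht⟩
        rw [List.cons_append, run_cons_of_isSorted hab hpush', run_cons_of_isSorted hab hpush,
          ← ihw _ hw.2 hxs]
        rfl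
      · have hpop : ¬IsSorted (x :: y :: (s ++ t)) := fun h =>
          hpush ((isSorted_append_of_disjoint hxs).1 h).1
        rw [List.cons_append, List.cons_append, run_cons_of_not_isSorted hab hpop,
          run_cons_of_not_isSorted hab hpush, List.cons_append, ← List.cons_append,
          ihs (List.disjoint_of_disjoint_cons_left hs)]

theorem run_cons_append_replicate (hab : a ≠ b) (x : A) (v : List A) (k : ℕ) {s : List A}
    (hs : x ∉ s) :
    run [a, b, a] (x :: v) (s ++ List.replicate (k + 1) x) =
      s ++ run [a, b, a] (x :: v) (List.replicate (k + 1) x) := by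
  induction s with
  | nil => rfl
  | cons y s ih =>
    rw [List.mem_cons, not_or] at hs
    have hpop : ¬IsSorted (x :: y :: (s ++ List.replicate (k + 1) x)) := fun h =>
      hs.1 (isSorted_iff_forall_clumped.1 h x y (by simp)).symm
    rw [List.cons_append, run_cons_of_not_isSorted hab hpop, ih hs.2, List.cons_append]

theorem run_replicate [DecidableEq A] (hab : a ≠ b) (x : A) (w : List A) (k : ℕ) :
    run [a, b, a] w (List.replicate (k + 1) x) =
      (w.splitOn x).flatMap (phi [a, b, a]) ++ List.replicate (w.count x + (k + 1)) x := by
  have ht := isSorted_replicate (k + 1) x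
  have hdisj {u : List A} (hu : x ∉ u) : u.Disjoint (List.replicate (k + 1) x) :=
    fun y hy hyx => hu (List.eq_of_mem_replicate hyx ▸ hy)
  induction w using splitOn_induction x generalizing k with
  | notMem w hw =>
    have := run_append_append hab ht (v := []) (fun s _ => by rw [run, run]) w [] (hdisj hw)
      (List.disjoint_nil_left _)
    rw [List.append_nil, List.nil_append, run.eq_1 _ (List.replicate _ _)] at this
    rw [this, List.splitOn_eq_singleton hw, List.count_eq_zero_of_not_mem hw, Nat.zero_add,
      List.flatMap_singleton, phi]
  | append_cons u v hu ih =>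
    have := run_append_append hab ht (v := x :: v)
      (fun s hs => run_cons_append_replicate hab x v k fun hx => hs hx (by simp)) u []
      (hdisj hu) (List.disjoint_nil_left _)
    rw [List.nil_append] at this
    rw [this, run_cons_of_isSorted hab (isSorted_replicate (k + 2) x), ← List.replicate_succ,
      ih (k + 1) (isSorted_replicate _ x) fun hu y hy hyx => hu (List.eq_of_mem_replicate hyx ▸ hy),
      List.splitOn_append_cons_self_of_not_mem hu, List.flatMap_cons, List.append_assoc,
      List.count_append, List.count_cons_self, List.count_eq_zero_of_not_mem hu, phi,
      show List.count x v + (k + 1 + 1) = 0 + (List.count x v + 1) + (k + 1) by omega]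

end Run

section AbaSort

variable [DecidableEq A]

@[simp]
theorem abaSort_nil : abaSort ([] : List A) = [] := by
  rw [abaSort]

theorem abaSort_cons (x : A) (w : List A) :
    abaSort (x :: w) = peel x w ++ List.replicate (w.count x + 1) x := by
  rw [abaSort, peel, List.flatMap_subtype fun _ _ => rfl, List.unattach_attach]

@[elab_as_elim]
theorem block_induction {P : List A → Prop} (nil : P [])
    (cons : ∀ x w, (∀ b ∈ w.splitOn x, P b) → P (x :: w)) (p : List A) : P p := by
  induction hn : p.length using Nat.strong_induction_on generalizing p with
  | _ n ih =>
    cases p with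
    | nil => exact nil
    | cons x w =>
      refine cons x w fun b hb => ih b.length ?_ b rfl
      rw [← hn]
      exact Nat.lt_succ_of_le (sublist_of_mem_splitOn hb).length_le

theorem phi_aba_eq_abaSort {a b : A} (hab : a ≠ b) : phi [a, b, a] = abaSort := by
  funext p
  induction p using block_induction with
  | nil => rw [phi, run, abaSort_nil]
  | cons x w ih =>
    rw [phi, run, abaSort_cons, peel, ← List.flatMap_congr ih]
    exact run_replicate hab x w 0

theorem abaSort_perm (p : List A) : (abaSort p).Perm p := by
  induction p using block_induction with
  | nil => simp
  | cons x w ih =>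
    have hpeel : (peel x w).Perm (w.filter (· ≠ x)) := by
      rw [← flatten_splitOn, ← List.flatMap_id]
      exact List.Perm.flatMap_left _ ih
    rw [abaSort_cons, List.replicate_succ]
    refine List.perm_middle.trans (.cons x ((hpeel.append_right _).trans ?_))
    simpa [← List.filter_eq] using List.filter_append_perm (· ≠ x) w

@[simp]
theorem mem_abaSort {z : A} {p : List A} : z ∈ abaSort p ↔ z ∈ p :=
  (abaSort_perm p).mem_iff

@[simp]
theorem mem_peel {x z : A} {w : List A} : z ∈ peel x w ↔ z ∈ w ∧ z ≠ x := by
  have hmem : z ∈ (w.splitOn x).flatten ↔ z ∈ w ∧ z ≠ x := by simp [flatten_splitOn]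
  rw [← hmem, peel]
  simp

theorem peel_of_notMem {x : A} {w : List A} (hx : x ∉ w) : peel x w = abaSort w := by
  rw [peel, List.splitOn_eq_singleton hx, List.flatMap_singleton]

theorem peel_append_cons {x : A} {u : List A} (hx : x ∉ u) (v : List A) :
    peel x (u ++ x :: v) = abaSort u ++ peel x v := by
  rw [peel, List.splitOn_append_cons_self_of_not_mem hx, List.flatMap_cons, peel]

theorem peel_replicate_append {x : A} {w : List A} (hx : x ∉ w) (m : ℕ) :
    peel x (List.replicate m x ++ w) = abaSort w := by
  rw [peel, splitOn_replicate_append hx, List.flatMap_append, List.flatMap_singleton,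
    List.flatMap_eq_nil_iff.2 fun b hb => by rw [List.eq_of_mem_replicate hb, abaSort_nil],
    List.nil_append]

theorem abaSort_append_of_nodup {B q : List A} (hB : B.Nodup) (hq : B.Disjoint q) :
    abaSort (B ++ q) = abaSort q ++ B.reverse := by
  induction B with
  | nil => simp
  | cons x B ih =>
    rw [List.nodup_cons] at hB
    rw [List.disjoint_cons_left] at hq
    have hx : x ∉ B ++ q := by simp [hB.1, hq.1]
    rw [List.cons_append, abaSort_cons, peel_of_notMem hx, List.count_eq_zero_of_not_mem hx,
      ih hB.2 hq.2, List.reverse_cons, List.append_assoc, List.replicate_one]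

theorem abaSort_of_nodup {w : List A} (hw : w.Nodup) : abaSort w = w.reverse := by
  simpa using abaSort_append_of_nodup hw (List.disjoint_nil_right w)

theorem abaSort_reverse {v : List A} (hv : v.Nodup) : abaSort v.reverse = v := by
  rw [abaSort_of_nodup (List.nodup_reverse.2 hv), List.reverse_reverse]

theorem getLast?_abaSort (p : List A) : (abaSort p).getLast? = p.head? := by
  cases p with
  | nil => simp
  | cons x w => simp [abaSort_cons, List.getLast?_replicate]

theorem clumped_abaSort_cons (x : A) (w : List A) : Clumped x (abaSort (x :: w)) := by
  rw [abaSort_cons]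
  exact clumped_append_replicate (by simp) _

theorem clumped_of_getLast?_abaSort {z : A} {p : List A} (h : (abaSort p).getLast? = some z) :
    Clumped z (abaSort p) := by
  rw [getLast?_abaSort, List.head?_eq_some_iff] at h
  obtain ⟨w, rfl⟩ := h
  exact clumped_abaSort_cons z w

theorem clumped_peel {x y : A} {w : List A} (hw : ¬[y, x, y].Sublist w)
    (hblocks : ∀ b ∈ w.splitOn x, Clumped y (abaSort b)) : Clumped y (peel x w) := by
  induction w using splitOn_induction x with
  | notMem w hx =>
    rw [peel_of_notMem hx]
    exact hblocks w (by rw [List.splitOn_eq_singleton hx]; exact List.mem_singleton_self w)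
  | append_cons u v hx ih =>
    rw [List.splitOn_append_cons_self_of_not_mem hx, List.forall_mem_cons] at hblocks
    rw [peel_append_cons hx]
    by_cases hyu : y ∈ u
    · have hyv : y ∉ v := fun hyv => hw (sublist_append_cons_of_mem hyu hyv)
      exact hblocks.1.append_right (by simp [hyv])
    · refine (ih (fun h => hw (h.trans ?_)) hblocks.2).append_left (by simpa using hyu)
      exact (List.sublist_cons_self x v).trans (List.sublist_append_right _ _)

theorem clumped_abaSort {y : A} {p : List A} (h : ∀ x ≠ y, ¬[x, y, x, y].Sublist p) :
    Clumped y (abaSort p) := by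
  induction p using block_induction with
  | nil => exact clumped_of_notMem (by simp)
  | cons x w ih =>
    by_cases hxy : x = y
    · exact hxy ▸ clumped_abaSort_cons x w
    · rw [abaSort_cons]
      refine (clumped_peel (fun hyxy => h x hxy (hyxy.cons_cons x)) fun b hb => ?_).append_right
        fun hy => hxy (List.eq_of_mem_replicate hy).symm
      exact ih b hb fun z hz hsub =>
        h z hz ((hsub.trans (sublist_of_mem_splitOn hb)).trans (List.sublist_cons_self x w))

theorem Clumped.abaSort {y : A} {p : List A} (h : Clumped y p) : Clumped y (abaSort p) :=
  clumped_abaSort fun x hx hsub => hx (h x ((List.sublist_cons_self x _).trans hsub))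

theorem abaSort_filter {C : A → Bool} {p : List A} (h : ∀ z, C z = false → Clumped z p) :
    abaSort (p.filter C) = (abaSort p).filter C := by
  induction p using block_induction with
  | nil => simp
  | cons x w ih =>
    have hblocks : ∀ b ∈ w.splitOn x, abaSort (b.filter C) = (abaSort b).filter C :=
      fun b hb => ih b hb fun z hz =>
        (h z hz).sublist ((sublist_of_mem_splitOn hb).trans (List.sublist_cons_self x w))
    cases hx : C x with
    | true =>
      rw [List.filter_cons_of_pos hx, abaSort_cons, abaSort_cons, List.filter_append,
        List.filter_replicate_of_pos hx, List.count_filter hx, peel, splitOn_filter hx,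
        List.flatMap_map, List.flatMap_congr hblocks, peel, List.filter_flatMap]
    | false =>
      obtain ⟨m, w, rfl, hw⟩ := (h x hx).exists_eq_replicate_append
      have hw_block : w ∈ (List.replicate m x ++ w).splitOn x := by
        simp [splitOn_replicate_append hw]
      rw [List.filter_cons_of_neg (by simp [hx]), List.filter_append,
        List.filter_replicate_of_neg (by simp [hx]), List.nil_append, hblocks w hw_block,
        abaSort_cons, peel_replicate_append hw, List.filter_append,
        List.filter_replicate_of_neg (by simp [hx]), List.append_nil]

theorem clumped_abaSort_of_head?_filter {C : A → Bool} {x : A} {p : List A}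
    (h : ∀ z, C z = false → Clumped z p) (hx : (p.filter C).head? = some x) :
    Clumped x (abaSort p) := by
  induction p using block_induction with
  | nil => simp at hx
  | cons y w ih =>
    cases hy : C y with
    | true =>
      rw [List.filter_cons_of_pos hy, List.head?_cons, Option.some_inj] at hx
      exact hx ▸ clumped_abaSort_cons y w
    | false =>
      obtain ⟨m, w, rfl, hw⟩ := (h y hy).exists_eq_replicate_append
      rw [List.filter_cons_of_neg (by simp [hy]), List.filter_append,
        List.filter_replicate_of_neg (by simp [hy]), List.nil_append] at hx
      have hw_sub : w.Sublist (y :: (List.replicate m y ++ w)) :=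
        (List.sublist_append_right _ _).trans (List.sublist_cons_self y _)
      have hxw : Clumped x (abaSort w) :=
        ih w (by simp [splitOn_replicate_append hw]) (fun z hz => (h z hz).sublist hw_sub) hx
      have hxy : x ≠ y := by
        rintro rfl
        exact hw (List.mem_of_mem_filter (List.mem_of_mem_head? hx))
      rw [abaSort_cons, peel_replicate_append hw]
      exact hxw.append_right fun hmem => hxy (List.eq_of_mem_replicate hmem)

end AbaSort

/-! ### Doubling a letter in place -/

/-- `Dup p q` says that the word `p` arises from `q` by doubling one letter in place. -/
def Dup (p q : List A) : Prop :=
  ∃ l b r, p = l ++ b :: b :: r ∧ q = l ++ b :: r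

namespace Dup

variable {p q : List A}

theorem append_left (h : Dup p q) (l : List A) : Dup (l ++ p) (l ++ q) := by
  obtain ⟨l', b, r, rfl, rfl⟩ := h
  exact ⟨l ++ l', b, r, by simp, by simp⟩

theorem append_right (h : Dup p q) (r : List A) : Dup (p ++ r) (q ++ r) := by
  obtain ⟨l, b, r', rfl, rfl⟩ := h
  exact ⟨l, b, r' ++ r, by simp, by simp⟩

theorem sublist (h : Dup p q) : q.Sublist p := by
  obtain ⟨l, b, r, rfl, rfl⟩ := h
  simp

theorem mem_iff (h : Dup p q) {z : A} : z ∈ p ↔ z ∈ q := by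
  obtain ⟨l, b, r, rfl, rfl⟩ := h
  simp

theorem length_eq (h : Dup p q) : p.length = q.length + 1 := by
  obtain ⟨l, b, r, rfl, rfl⟩ := h
  simp only [List.length_append, List.length_cons]
  omega

theorem head?_eq (h : Dup p q) : p.head? = q.head? := by
  obtain ⟨l, b, r, rfl, rfl⟩ := h
  cases l <;> simp

theorem getLast?_eq (h : Dup p q) : p.getLast? = q.getLast? := by
  obtain ⟨l, b, r, rfl, rfl⟩ := h
  simp [List.getLast?_append, List.getLast?_cons]

theorem filter (h : Dup p q) (C : A → Bool) :
    p.filter C = q.filter C ∨ Dup (p.filter C) (q.filter C) := by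
  obtain ⟨l, b, r, rfl, rfl⟩ := h
  by_cases hb : C b
  · exact Or.inr ⟨l.filter C, b, r.filter C, by simp [hb], by simp [hb]⟩
  · exact Or.inl (by simp [hb])

theorem sublist_of_isChain (h : Dup p q) {t : List A} (ht : t.IsChain (· ≠ ·))
    (hp : t.Sublist p) : t.Sublist q := by
  obtain ⟨l, b, r, rfl, rfl⟩ := h
  obtain ⟨t₁, t₂, rfl, h₁, h₂⟩ := List.sublist_append_iff.1 hp
  refine h₁.append ?_
  rcases List.sublist_cons_iff.1 h₂ with h₂ | ⟨t₃, rfl, h₃⟩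
  · exact h₂
  rcases List.sublist_cons_iff.1 h₃ with h₃ | ⟨t₄, rfl, -⟩
  · exact h₃.cons_cons b
  · exact absurd rfl (List.isChain_append.1 ht).2.1.rel

theorem not_isChain (h : Dup p q) : ¬p.IsChain (· ≠ ·) := by
  obtain ⟨l, b, r, rfl, -⟩ := h
  exact fun hp => (List.isChain_append.1 hp).2.1.rel rfl

theorem clumped (h : Dup p q) {z : A} (hq : Clumped z q) : Clumped z p := by
  intro y hy
  by_contra hyz
  exact hyz (hq y (h.sublist_of_isChain (by simp [hyz, Ne.symm hyz]) hy))

theorem not_isSorted (h : Dup p q) (hq : ¬IsSorted q) : ¬IsSorted p :=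
  fun hp => hq (hp.sublist h.sublist)

end Dup

section DupPass

variable [DecidableEq A]

theorem Dup.peel {x b : A} (hb : b ≠ x) (l r : List A)
    (ih : ∀ q ∈ (l ++ b :: r).splitOn x, ∀ p, Dup p q → Dup (abaSort p) (abaSort q)) :
    Dup (peel x (l ++ b :: b :: r)) (peel x (l ++ b :: r)) := by
  induction l using splitOn_induction x with
  | notMem l hl =>
    by_cases hr : x ∈ r
    · obtain ⟨r₁, r₂, rfl, hr₁⟩ := List.eq_append_cons_of_mem hr
      have hu : x ∉ l ++ b :: r₁ := by simp [hl, hb.symm, hr₁]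
      have hu' : x ∉ l ++ b :: b :: r₁ := by simp [hl, hb.symm, hr₁]
      have hblock : l ++ b :: r₁ ∈ (l ++ b :: (r₁ ++ x :: r₂)).splitOn x := by
        rw [← List.cons_append, ← List.append_assoc, List.splitOn_append_cons_self_of_not_mem hu]
        exact List.mem_cons_self
      have := (ih _ hblock _ ⟨l, b, r₁, rfl, rfl⟩).append_right (StackSort.peel x r₂)
      rw [← peel_append_cons hu, ← peel_append_cons hu'] at this
      simpa using this
    · have hu : x ∉ l ++ b :: r := by simp [hl, hb.symm, hr]
      rw [peel_of_notMem hu, peel_of_notMem (by simp [hl, hb.symm, hr])]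
      exact ih _ (by simp [List.splitOn_eq_singleton hu]) _ ⟨l, b, r, rfl, rfl⟩
  | append_cons u v hu ihv =>
    rw [List.append_assoc, List.cons_append, List.splitOn_append_cons_self_of_not_mem hu] at ih
    simp only [List.append_assoc, List.cons_append, peel_append_cons hu]
    exact (ihv fun q hq => ih q (List.mem_cons_of_mem u hq)).append_left _

theorem Dup.abaSort {p q : List A} (h : Dup p q) : Dup (abaSort p) (abaSort q) := by
  induction q using block_induction generalizing p with
  | nil =>
    obtain ⟨l, b, r, -, hq⟩ := h
    simp at hq
  | cons x w ih =>
    obtain ⟨l, b, r, rfl, hq⟩ := h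
    have hdup {w' : List A} (hpeel : StackSort.peel x w' = StackSort.peel x w)
        (hcount : w'.count x = w.count x + 1) :
        Dup (StackSort.abaSort (x :: w')) (StackSort.abaSort (x :: w)) := by
      rw [abaSort_cons, abaSort_cons, hpeel, hcount]
      exact ⟨_, x, List.replicate (w.count x) x, rfl, rfl⟩
    cases l with
    | nil =>
      obtain ⟨rfl, rfl⟩ := List.cons.inj hq
      refine hdup ?_ List.count_cons_self
      simpa using peel_append_cons (u := []) List.not_mem_nil w
    | cons y l =>
      obtain ⟨rfl, rfl⟩ := List.cons.inj hq
      by_cases hb : b = x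
      · subst hb
        refine hdup ?_ (by simp [Nat.add_assoc])
        simp [StackSort.peel, List.splitOn_append_cons_self, List.splitOn_cons_eq_if_modifyHead]
      · simpa [abaSort_cons, hb] using (Dup.peel hb l r fun q hq p => ih q hq).append_right _

theorem Dup.iterate_abaSort {p q : List A} (h : Dup p q) (k : ℕ) :
    Dup (StackSort.abaSort^[k] p) (StackSort.abaSort^[k] q) := by
  induction k generalizing p q with
  | zero => exact h
  | succ _ ih => exact ih h.abaSort

theorem nodup_or_exists_dup_abaSort (w : List A) : w.Nodup ∨ ∃ q, Dup (abaSort w) q := by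
  induction w using block_induction with
  | nil => exact Or.inl List.nodup_nil
  | cons x w ih =>
    rw [abaSort_cons]
    by_cases hx : x ∈ w
    · obtain ⟨k, hk⟩ := Nat.exists_eq_succ_of_ne_zero (List.count_pos_iff.2 hx).ne'
      exact Or.inr ⟨_, peel x w, x, List.replicate k x, by rw [hk]; rfl, rfl⟩
    · rw [peel_of_notMem hx]
      rcases ih w (by simp [List.splitOn_eq_singleton hx]) with hw | ⟨q, hq⟩
      · exact Or.inl (List.nodup_cons.2 ⟨hx, hw⟩)
      · exact Or.inr ⟨_, hq.append_right _⟩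

theorem peel_eq_filter_abaSort (x : A) (w : List A) :
    peel x w = (abaSort (x :: w)).filter (· ≠ x) := by
  rw [abaSort_cons, List.filter_append, List.filter_replicate_of_neg (by simp), List.append_nil,
    List.filter_eq_self.2]
  simp

end DupPass

/-! ### Tight words -/

section Tight

variable [DecidableEq A]

theorem clumped_abaSort_of_notMem_erase {D : Finset A} {p : List A} {x : A}
    (hp : ∀ z ∉ D, Clumped z p) (hx : Clumped x (abaSort p)) :
    ∀ z ∉ D.erase x, Clumped z (abaSort p) := by
  intro z hz
  by_cases hzx : z = x
  · exact hzx ▸ hx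
  · exact (hp z fun hzD => hz (Finset.mem_erase.2 ⟨hzx, hzD⟩)).abaSort

theorem exists_mem_clumped_abaSort {D : Finset A} (hD : D.Nonempty) {p : List A}
    (hp : ∀ z ∉ D, Clumped z p) : ∃ x ∈ D, Clumped x (abaSort p) := by
  rcases hq : (p.filter (· ∈ D)).head? with _ | x
  · obtain ⟨x, hx⟩ := hD
    rw [List.head?_eq_none_iff, List.filter_eq_nil_iff] at hq
    exact ⟨x, hx, (clumped_of_notMem fun hxp => hq x hxp (decide_eq_true hx)).abaSort⟩
  · have hx := (List.mem_filter.1 (List.mem_of_mem_head? hq)).2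
    exact ⟨x, of_decide_eq_true hx,
      clumped_abaSort_of_head?_filter (fun z hz => hp z (of_decide_eq_false hz)) hq⟩

theorem isSorted_iterate_abaSort {n : ℕ} {D : Finset A} {p : List A} (hD : D.card = n)
    (hp : ∀ z ∉ D, Clumped z p) : IsSorted (abaSort^[n] p) := by
  induction n generalizing D p with
  | zero =>
    rw [Finset.card_eq_zero] at hD
    exact isSorted_iff_forall_clumped.2 fun z => hp z (by simp [hD])
  | succ n ih =>
    obtain ⟨x, hxD, hx⟩ := exists_mem_clumped_abaSort (Finset.card_pos.1 (by omega)) hp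
    exact ih (by rw [Finset.card_erase_of_mem hxD, hD, Nat.add_sub_cancel])
      (clumped_abaSort_of_notMem_erase hp hx)

/-- No letter of the word is clumped, and this persists when, again and again, a pass is made and
the former first letter is deleted, until at most one letter is left. Words whose sorting takes as
many passes as it possibly can are of this kind. -/
inductive Tight : List A → Prop
  | of_subsingleton {q : List A} (h : ∀ y ∈ q, ∀ z ∈ q, y = z) : Tight q
  | cons {x : A} {w : List A} (h : ∀ z ∈ x :: w, ¬Clumped z (x :: w)) (hpeel : Tight (peel x w)) :
      Tight (x :: w)

theorem Tight.eq_of_clumped {q : List A} (h : Tight q) {y z : A} (hz : z ∈ q)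
    (hclumped : Clumped z q) (hy : y ∈ q) : y = z := by
  cases h with
  | of_subsingleton h => exact h y hy z hz
  | cons h _ => exact absurd hclumped (h z hz)

theorem tight_cons {x : A} {w : List A} (h : ∀ z ∈ w, z ≠ x → ¬Clumped z (x :: w))
    (hpeel : Tight (peel x w)) : Tight (x :: w) := by
  by_cases hx : Clumped x (x :: w)
  · obtain ⟨m, w, rfl, hw⟩ := hx.exists_eq_replicate_append
    rw [peel_replicate_append hw] at hpeel
    cases w with
    | nil => exact .of_subsingleton (by simp)
    | cons c w =>
      have hcx : c ≠ x := fun hcx => hw (hcx ▸ List.mem_cons_self)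
      have hc : ∀ y ∈ c :: w, y = c := fun y hy =>
        hpeel.eq_of_clumped (by simp) (clumped_abaSort_cons c w) (by simpa using hy)
      refine absurd ?_ (h c (by simp) hcx)
      exact (clumped_of_forall_eq hc).append_left (l := x :: List.replicate m x) (by simp [hcx])
  · refine .cons (fun z hz => ?_) hpeel
    by_cases hzx : z = x
    · exact hzx ▸ hx
    · exact h z ((List.mem_cons.1 hz).resolve_left hzx) hzx

-- Were `z` clumped, then the next pass would clump `z` together with the first letter.
theorem not_clumped_filter_of_not_isSorted {n : ℕ} {D : Finset A} {p : List A}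
    (hD : D.card = n + 2) (hp : ∀ z ∉ D, Clumped z p) (hns : ¬IsSorted (abaSort^[n + 1] p))
    {x z : A} (hxD : x ∈ D) (hx : Clumped x (abaSort p)) (hzD : z ∈ D) (hzx : z ≠ x) :
    ¬Clumped z (p.filter (· ∈ D)) := by
  intro hc
  have hz : Clumped z (abaSort p) := by
    refine clumped_abaSort fun y hy hsub => ?_
    by_cases hyD : y ∈ D
    · have hfilter : [y, z, y, z].Sublist (p.filter (· ∈ D)) := by
        simpa [hyD, hzD] using hsub.filter (· ∈ D)
      exact hy (hc y ((List.sublist_cons_self y _).trans hfilter))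
    · exact hy (hp y hyD z ((by simp : [y, z, y].Sublist [y, z, y, z]).trans hsub)).symm
  refine hns (isSorted_iterate_abaSort (n := n) (D := (D.erase x).erase z) ?_ fun y hy => ?_)
  · rw [Finset.card_erase_of_mem (Finset.mem_erase.2 ⟨hzx, hzD⟩), Finset.card_erase_of_mem hxD, hD]
    omega
  · by_cases hyz : y = z
    · exact hyz ▸ hz
    · exact clumped_abaSort_of_notMem_erase hp hx y fun h => hy (Finset.mem_erase.2 ⟨hyz, h⟩)

theorem tight_filter_of_not_isSorted {n : ℕ} {D : Finset A} {p : List A} (hD : D.card = n + 1)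
    (hp : ∀ z ∉ D, Clumped z p) (hns : ¬IsSorted (abaSort^[n] p)) :
    Tight (p.filter (· ∈ D)) := by
  induction n generalizing D p with
  | zero =>
    obtain ⟨x, rfl⟩ := Finset.card_eq_one.1 hD
    exact .of_subsingleton (by simp +contextual)
  | succ n ih =>
    have hp' : ∀ z, decide (z ∈ D) = false → Clumped z p := fun z hz => hp z (of_decide_eq_false hz)
    rcases hq : p.filter (· ∈ D) with _ | ⟨x, w⟩
    · exact .of_subsingleton (by simp)
    have hD_of_mem : ∀ z ∈ x :: w, z ∈ D := fun z hz =>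
      of_decide_eq_true (List.mem_filter.1 (hq ▸ hz : z ∈ p.filter (· ∈ D))).2
    have hxD := hD_of_mem x List.mem_cons_self
    have hx := clumped_abaSort_of_head?_filter hp' (hq ▸ List.head?_cons)
    have hpeel : peel x w = (abaSort p).filter (· ∈ D.erase x) := by
      rw [peel_eq_filter_abaSort, ← hq, abaSort_filter hp', List.filter_filter]
      simp
    refine tight_cons (fun z hz hzx => ?_) ?_
    · rw [← hq]
      exact not_clumped_filter_of_not_isSorted hD hp hns hxD hx
        (hD_of_mem z (List.mem_cons_of_mem x hz)) hzx
    · rw [hpeel]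
      exact ih (by rw [Finset.card_erase_of_mem hxD, hD, Nat.add_sub_cancel])
        (clumped_abaSort_of_notMem_erase hp hx) hns

theorem Dup.tight {p q : List A} (h : Dup p q) (hp : Tight p) : Tight q := by
  induction hp generalizing q with
  | of_subsingleton hp =>
    exact .of_subsingleton fun y hy z hz => hp y (h.sublist.subset hy) z (h.sublist.subset hz)
  | @cons x w hp hpeel ih =>
    obtain ⟨w', rfl⟩ := List.head?_eq_some_iff.1 (h.head?_eq.symm.trans List.head?_cons)
    refine .cons (fun z hz hc => hp z (h.sublist.subset hz) (h.clumped hc)) ?_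
    have hfilter := h.abaSort.filter (· ≠ x)
    rw [← peel_eq_filter_abaSort, ← peel_eq_filter_abaSort] at hfilter
    rcases hfilter with heq | hdup
    · exact heq ▸ hpeel
    · exact ih hdup

end Tight

/-! ### Squares -/

theorem exists_dup_of_dup_append_self {v q : List A} (h : Dup q (v ++ v)) :
    ∃ u, Dup u v ∧ (q = u ++ v ∨ q = v ++ u) := by
  obtain ⟨l, b, r, rfl, hq⟩ := h
  rcases List.append_eq_append_iff.1 hq with ⟨l', rfl, hv⟩ | ⟨_ | ⟨b', r'⟩, hv, hr⟩
  · exact ⟨l' ++ b :: b :: r, ⟨l', b, r, rfl, hv⟩, Or.inr (by simp)⟩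
  · exact ⟨b :: b :: r, ⟨[], b, r, rfl, by simpa using hr.symm⟩, Or.inr (by simp [hv])⟩
  · obtain ⟨rfl, rfl⟩ := List.cons.inj hr
    exact ⟨l ++ b :: b :: r', ⟨l, b, r', rfl, hv⟩, Or.inl (by simp)⟩

theorem exists_head?_ne_getLast? {v : List A} (hv : v.Nodup) (hlen : 2 ≤ v.length) :
    ∃ y z, v.head? = some y ∧ v.getLast? = some z ∧ y ≠ z := by
  match v, hlen with
  | y :: y' :: v, _ =>
    have hne : y' :: v ≠ [] := List.cons_ne_nil y' v
    refine ⟨y, (y' :: v).getLast hne, rfl, ?_, ?_⟩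
    · rw [List.getLast?_cons_cons, List.getLast?_eq_some_getLast hne]
    · exact fun h => (List.nodup_cons.1 hv).1 (h ▸ List.getLast_mem hne)

theorem pair_sublist_of_getLast? {l : List A} {y z : A} (hy : y ∈ l) (hz : l.getLast? = some z)
    (hyz : y ≠ z) : [y, z].Sublist l := by
  obtain ⟨l, rfl⟩ := List.getLast?_eq_some_iff.1 hz
  have hyl : y ∈ l := by simpa [hyz] using hy
  exact (List.singleton_sublist.2 hyl).append_right [z]

theorem isChain_append_self {v : List A} (hv : v.Nodup) (hlen : 2 ≤ v.length) :
    (v ++ v).IsChain (· ≠ ·) := by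
  obtain ⟨y, z, hy, hz, hyz⟩ := exists_head?_ne_getLast? hv hlen
  refine List.isChain_append.2 ⟨hv.isChain, hv.isChain, ?_⟩
  simpa [hy, hz] using hyz.symm

section Square

variable [DecidableEq A]

theorem count_peel {x z : A} (hz : z ≠ x) (w : List A) : (peel x w).count z = w.count z := by
  rw [peel_eq_filter_abaSort, List.count_filter (by simpa using hz), (abaSort_perm _).count_eq,
    List.count_cons_of_ne hz.symm]

theorem eq_reverse_of_abaSort_eq {w v : List A} (hv : v.Nodup) (h : abaSort w = v) :
    w = v.reverse := by
  have hw : w.Nodup := (abaSort_perm w).nodup_iff.1 (h ▸ hv)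
  rw [← h, abaSort_of_nodup hw, List.reverse_reverse]

theorem nodup_of_isChain_abaSort {w : List A} (h : (abaSort w).IsChain (· ≠ ·)) : w.Nodup :=
  (nodup_or_exists_dup_abaSort w).resolve_right fun ⟨_, hq⟩ => hq.not_isChain h

theorem abaSort_ne_append_of_mem {w l u : List A} {y z : A} (hyz : y ≠ z)
    (hhead : u.head? = some y) (hlast : u.getLast? = some z) (hz : z ∈ l) :
    abaSort w ≠ l ++ u := by
  intro h
  have hclumped : Clumped z (l ++ u) := by
    rw [← h]
    exact clumped_of_getLast?_abaSort (by rw [h, List.getLast?_append, hlast, Option.some_or])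
  have hyzu := pair_sublist_of_getLast? (List.mem_of_mem_head? hhead) hlast hyz
  exact hyz (hclumped y ((List.singleton_sublist.2 hz).append hyzu))

theorem abaSort_ne_append_of_subset {w l r : List A} {y z : A} (hyz : y ≠ z)
    (hlast : l.getLast? = some z) (hhead : r.head? = some y) (hsub : r ⊆ l) :
    abaSort w ≠ l ++ r := by
  intro h
  have hyr : y ∈ r := List.mem_of_mem_head? hhead
  obtain ⟨d, hd⟩ : ∃ d, r.getLast? = some d :=
    Option.isSome_iff_exists.1 (by simpa using List.ne_nil_of_mem hyr)
  have hdr : d ∈ r := List.mem_of_mem_getLast? hd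
  have hdl : d ∈ l := hsub hdr
  have hclumped : Clumped d (l ++ r) := by
    rw [← h]
    exact clumped_of_getLast?_abaSort (by rw [h, List.getLast?_append, hd, Option.some_or])
  by_cases hdz : d = z
  · have hydr := pair_sublist_of_getLast? hyr hd (hdz ▸ hyz)
    exact hyz ((hclumped y ((List.singleton_sublist.2 hdl).append hydr)).trans hdz)
  · have hdzl := pair_sublist_of_getLast? hdl hlast hdz
    exact hdz (hclumped z (hdzl.append (List.singleton_sublist.2 hdr))).symm

theorem abaSort_append_inj {w₁ w₂ u₁ u₂ : List A} {y z : A} (hyz : y ≠ z)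
    (hlast₁ : u₁.getLast? = some z) (hlast₂ : u₂.getLast? = some z) (hhead₂ : u₂.head? = some y)
    (hsub : u₂ ⊆ u₁) (h : abaSort w₁ ++ abaSort w₂ = u₁ ++ u₂) :
    abaSort w₁ = u₁ ∧ abaSort w₂ = u₂ := by
  rcases List.append_eq_append_iff.1 h with ⟨r, h₁, h₂⟩ | ⟨r, h₁, h₂⟩
  · by_cases hr : r = []
    · subst hr
      exact ⟨by simpa using h₁.symm, h₂⟩
    · have hz : r.getLast? = some z := by
        rwa [h₁, List.getLast?_append_of_ne_nil _ hr] at hlast₁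
      exact absurd h₂ (abaSort_ne_append_of_mem hyz hhead₂ hlast₂ (List.mem_of_mem_getLast? hz))
  · by_cases hr : r = []
    · subst hr
      exact ⟨by simpa using h₁, h₂.symm⟩
    · rw [h₂] at hsub
      rw [h₂, List.head?_append_of_ne_nil _ hr] at hhead₂
      exact absurd h₁ (abaSort_ne_append_of_subset hyz hlast₁ hhead₂ (List.append_subset.1 hsub).1)

theorem eq_reverse_of_append_eq_append_self {v w₁ w₂ : List A} (hv : v.Nodup)
    (hlen : 2 ≤ v.length) (h : abaSort w₁ ++ abaSort w₂ = v ++ v) :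
    w₁ = v.reverse ∧ w₂ = v.reverse := by
  obtain ⟨y, z, hy, hz, hyz⟩ := exists_head?_ne_getLast? hv hlen
  obtain ⟨h₁, h₂⟩ := abaSort_append_inj hyz hz hz hy (List.Subset.refl v) h
  exact ⟨eq_reverse_of_abaSort_eq hv h₁, eq_reverse_of_abaSort_eq hv h₂⟩

theorem exists_eq_append_cons_of_count_eq_succ {x : A} {w : List A} {n : ℕ}
    (h : w.count x = n + 1) : ∃ w₁ w₂, w = w₁ ++ x :: w₂ ∧ x ∉ w₁ ∧ w₂.count x = n := by
  have hx : x ∈ w := List.count_pos_iff.1 (by omega)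
  obtain ⟨w₁, w₂, rfl, hw₁⟩ := List.eq_append_cons_of_mem hx
  refine ⟨w₁, w₂, rfl, hw₁, ?_⟩
  rw [List.count_append, List.count_cons_self, List.count_eq_zero_of_not_mem hw₁] at h
  omega

theorem eq_singleton_of_not_clumped {x z : A} {w₁ w₂ : List A} (hzx : z ≠ x)
    (hz : ¬Clumped z (x :: (w₁ ++ x :: w₂))) (h : abaSort w₁ ++ abaSort w₂ = [z, z]) :
    w₁ = [z] ∧ w₂ = [z] := by
  have hall : ∀ y ∈ w₁ ++ w₂, y = z := fun y hy => by
    have : y ∈ abaSort w₁ ++ abaSort w₂ := by simpa using hy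
    simpa [h] using this
  have hlen : w₁.length + w₂.length = 2 := by
    simpa [(abaSort_perm _).length_eq] using congrArg List.length h
  have hne₁ : w₁ ≠ [] := by
    rintro rfl
    exact hz ((clumped_of_forall_eq hall).append_left (l := [x, x]) (by simp [hzx]))
  have hne₂ : w₂ ≠ [] := by
    rintro rfl
    rw [List.append_nil] at hall
    exact hz (((clumped_of_forall_eq hall).append_right (r := [x]) (by simp [hzx])).cons hzx)
  have hpos₁ := List.length_pos_iff.2 hne₁
  have hpos₂ := List.length_pos_iff.2 hne₂
  obtain ⟨y₁, rfl⟩ := List.length_eq_one_iff.1 (by omega : w₁.length = 1)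
  obtain ⟨y₂, rfl⟩ := List.length_eq_one_iff.1 (by omega : w₂.length = 1)
  exact ⟨by rw [hall y₁ (by simp)], by rw [hall y₂ (by simp)]⟩

theorem Tight.exists_eq_append_self {q : List A} (h : Tight q) (hcount : ∀ z ∈ q, q.count z = 2) :
    ∃ v : List A, v.Nodup ∧ q = v ++ v := by
  induction h with
  | @of_subsingleton q h =>
    cases q with
    | nil => exact ⟨[], List.nodup_nil, rfl⟩
    | cons x w =>
      have hrep : x :: w = List.replicate (x :: w).length x :=
        List.eq_replicate_of_mem fun z hz => h z hz x List.mem_cons_self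
      have hlen : (x :: w).length = 2 := by
        rw [← hcount x List.mem_cons_self, hrep, List.count_replicate_self, List.length_replicate]
      exact ⟨[x], List.nodup_singleton x, by rw [hrep, hlen]; rfl⟩
  | @cons x w h _ ih =>
    have hx : w.count x = 0 + 1 := by simpa using hcount x List.mem_cons_self
    obtain ⟨w₁, w₂, rfl, hx₁, hx₂⟩ := exists_eq_append_cons_of_count_eq_succ hx
    rw [List.count_eq_zero] at hx₂
    obtain ⟨v, hv, hpeel⟩ := ih fun z hz => by
      rw [mem_peel] at hz
      rw [count_peel hz.2, ← hcount z (List.mem_cons_of_mem x hz.1),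
        List.count_cons_of_ne hz.2.symm]
    have hxv : x ∉ v := fun hxv =>
      (mem_peel.1 (hpeel ▸ List.mem_append_left v hxv : x ∈ peel x _)).2 rfl
    rw [peel_append_cons hx₁, peel_of_notMem hx₂] at hpeel
    suffices hw : w₁ = v.reverse ∧ w₂ = v.reverse by
      exact ⟨x :: v.reverse, by simpa using ⟨hxv, hv⟩, by simp [hw]⟩
    match v with
    | [] =>
      have hnil := List.append_eq_nil_iff.1 hpeel
      exact ⟨eq_reverse_of_abaSort_eq List.nodup_nil hnil.1,
        eq_reverse_of_abaSort_eq List.nodup_nil hnil.2⟩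
    | [z] =>
      have hz : z ∈ abaSort w₁ ++ abaSort w₂ := by simp [hpeel]
      refine eq_singleton_of_not_clumped (fun hzx => hxv (by simp [hzx])) (h z ?_) hpeel
      simp only [List.mem_append, mem_abaSort] at hz
      simp only [List.mem_cons, List.mem_append]
      tauto
    | y :: z :: v => exact eq_reverse_of_append_eq_append_self hv (by simp) hpeel

end Square

theorem dup_iff_exists_take_append_drop {p q : List A} :
    Dup p q ↔ ∃ k < q.length, p = q.take (k + 1) ++ q.drop k := by
  constructor
  · rintro ⟨l, b, r, rfl, rfl⟩
    exact ⟨l.length, by simp, by simp [List.take_append]⟩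
  · rintro ⟨k, hk, rfl⟩
    refine ⟨q.take k, q[k], q.drop (k + 1), ?_, by simp⟩
    rw [List.getElem_cons_drop, List.append_cons, List.take_append_getElem hk]

theorem take_succ_append_drop_ne {v : List A} (hv : v.Nodup) {k k' : ℕ} (hkk' : k < k')
    (hk' : k' < v.length) : v.take (k + 1) ++ v.drop k ≠ v.take (k' + 1) ++ v.drop k' := by
  intro h
  have hk : k + 1 < v.length := by omega
  have hget : v[k] = v[k + 1] := by
    have hget := congrArg (·[k + 1]?) h
    simpa [List.getElem?_append, List.getElem?_take, hk, hkk', hkk'.trans hk', hk.le,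
      hk'.le] using hget
  exact absurd (hv.getElem_inj_iff.1 hget) (by omega)

/-- The words that one pass turns into `v` with the letter at index `k` doubled; there is one of
them for every `j ≤ k`. -/
def undouble (v : List A) (k j : ℕ) : List A :=
  ((v.take (k + 1)).drop j ++ v.take j ++ v.drop k).reverse

theorem undouble_append_cons (α β : List A) (c : A) {j : ℕ} (hj : j ≤ α.length) :
    undouble (α ++ c :: β) α.length j =
      β.reverse ++ c :: ((α.take j).reverse ++ c :: (α.drop j).reverse) := by
  have htake : (α ++ c :: β).take (α.length + 1) = α ++ [c] := by simp [List.take_append]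
  simp [undouble, htake, List.take_append_of_le_length hj, List.drop_append_of_le_length hj]

theorem map_undouble (f : A → A) (v : List A) (k j : ℕ) :
    (undouble v k j).map f = undouble (v.map f) k j := by
  simp [undouble]

theorem length_undouble {v : List A} {k j : ℕ} (hj : j ≤ k) (hk : k < v.length) :
    (undouble v k j).length = v.length + 1 := by
  simp only [undouble, List.length_reverse, List.length_append, List.length_drop, List.length_take]
  omega

theorem subset_undouble (v : List A) (k j : ℕ) : undouble v k j ⊆ v := by
  intro z hz
  simp only [undouble, List.mem_reverse, List.mem_append] at hz
  rcases hz with (hz | hz) | hz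
  · exact List.mem_of_mem_take (List.mem_of_mem_drop hz)
  · exact List.mem_of_mem_take hz
  · exact List.mem_of_mem_drop hz

section Undouble

variable [DecidableEq A]

theorem abaSort_append_cons_append_cons {B u v : List A} {y : A} (hu : (B ++ y :: u).Nodup)
    (hv : (B ++ y :: v).Nodup) :
    abaSort (B ++ y :: (u ++ y :: v)) = u.reverse ++ v.reverse ++ y :: y :: B.reverse := by
  obtain ⟨hB, hyu, hBu⟩ := List.nodup_append'.1 hu
  obtain ⟨-, hyv, hBv⟩ := List.nodup_append'.1 hv
  obtain ⟨hy, hu⟩ := List.nodup_cons.1 hyu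
  obtain ⟨hy', hv⟩ := List.nodup_cons.1 hyv
  have hdisj : B.Disjoint (y :: (u ++ y :: v)) := by
    simp only [List.disjoint_cons_right, List.disjoint_append_right] at hBu hBv ⊢
    exact ⟨hBu.1, hBu.2, hBv⟩
  rw [abaSort_append_of_nodup hB hdisj, abaSort_cons, peel_append_cons hy, peel_of_notMem hy',
    abaSort_of_nodup hu, abaSort_of_nodup hv]
  simp [List.count_eq_zero_of_not_mem hy, List.count_eq_zero_of_not_mem hy', List.replicate]

theorem abaSort_undouble {v : List A} (hv : v.Nodup) {k j : ℕ} (hj : j ≤ k) (hk : k < v.length) :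
    abaSort (undouble v k j) = v.take (k + 1) ++ v.drop k := by
  obtain ⟨α, c, β, rfl, rfl⟩ : ∃ α c β, v = α ++ c :: β ∧ α.length = k :=
    ⟨v.take k, v[k], v.drop (k + 1), by simp, by simp [hk.le]⟩
  have hrev : (β.reverse ++ c :: α.reverse).Nodup := by simpa using List.nodup_reverse.2 hv
  have hsub {l : List A} (hl : l.Sublist α) : (β.reverse ++ c :: l.reverse).Nodup :=
    hrev.sublist ((hl.reverse.cons_cons c).append_left _)
  rw [undouble_append_cons α β c hj, abaSort_append_cons_append_cons
    (hsub (List.take_sublist j α)) (hsub (List.drop_sublist j α))]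
  simp [List.take_append]

theorem exists_eq_undouble_of_abaSort_eq {w v : List A} (hv : v.Nodup) {k : ℕ} (hk : k < v.length)
    (h : abaSort w = v.take (k + 1) ++ v.drop k) : ∃ j ≤ k, w = undouble v k j := by
  obtain ⟨α, c, β, rfl, rfl⟩ : ∃ α c β, v = α ++ c :: β ∧ α.length = k :=
    ⟨v.take k, v[k], v.drop (k + 1), by simp, by simp [hk.le]⟩
  replace h : abaSort w = α ++ c :: c :: β := by
    rw [h]
    simp [List.take_append, List.take_of_length_le]
  obtain ⟨hc, hαβ⟩ := List.nodup_cons.1 (List.nodup_middle.1 hv)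
  obtain ⟨hcα, hcβ⟩ := not_or.1 (mt List.mem_append.2 hc)
  have hcount : w.count c = 1 + 1 := by
    rw [← (abaSort_perm w).count_eq, h]
    simp [List.count_eq_zero_of_not_mem, hcα, hcβ]
  obtain ⟨δ, w, rfl, hcδ, hcount⟩ := exists_eq_append_cons_of_count_eq_succ hcount
  obtain ⟨ε, ζ, rfl, hcε, hcζ⟩ := exists_eq_append_cons_of_count_eq_succ (n := 0) hcount
  rw [List.count_eq_zero] at hcζ
  have hperm : (c :: (δ ++ (ε ++ ζ))).Perm (α ++ c :: β) := by
    have := h ▸ (abaSort_perm (δ ++ c :: (ε ++ c :: ζ))).symm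
    rw [List.perm_iff_count] at this ⊢
    intro z
    specialize this z
    simp only [List.count_append, List.count_cons] at this ⊢
    omega
  have hnodup : (δ ++ c :: (ε ++ ζ)).Nodup := List.nodup_middle.2 (hperm.nodup_iff.2 hv)
  rw [abaSort_append_cons_append_cons (hnodup.sublist (by simp)) (hnodup.sublist (by simp))] at h
  replace h := congrArg (List.erase · c) h
  simp only [List.erase_append_right, List.erase_cons_head, hcα, hcε, hcζ, List.mem_append,
    List.mem_reverse, or_self, not_false_eq_true] at h
  obtain ⟨rfl, -, rfl⟩ :=
    (List.append_cons_inj_of_notMem (by simp [hcε, hcζ]) (by simp [hcδ])).1 h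
  refine ⟨ε.length, by simp, ?_⟩
  rw [undouble_append_cons _ _ _ (by simp)]
  simp

end Undouble

theorem undouble_inj {v : List A} (hv : v.Nodup) {k j k' j' : ℕ} (hj : j ≤ k) (hk : k < v.length)
    (hj' : j' ≤ k') (hk' : k' < v.length) :
    undouble v k j = undouble v k' j' ↔ k = k' ∧ j = j' := by
  classical
  refine ⟨fun h => ?_, by rintro ⟨rfl, rfl⟩; rfl⟩
  have hsort := congrArg abaSort h
  rw [abaSort_undouble hv hj hk, abaSort_undouble hv hj' hk'] at hsort
  obtain rfl : k = k' := by
    rcases lt_trichotomy k k' with hlt | heq | hgt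
    · exact absurd hsort (take_succ_append_drop_ne hv hlt hk')
    · exact heq
    · exact absurd hsort.symm (take_succ_append_drop_ne hv hgt hk)
  refine ⟨rfl, ?_⟩
  have hget : v[j] = v[j'] := by
    have hget := congrArg (·[0]?) (List.reverse_injective h)
    simpa [List.append_assoc, List.getElem?_append, List.getElem?_take, hj, hj', hk.le,
      hj.trans_lt hk, hj'.trans_lt hk] using hget
  exact hv.getElem_inj_iff.1 hget

/-! ### The three families -/

/-- The parameters of the three families of words in `gaps`. An unordered pair `s(j, k)` stands for
the inequality `j ≤ k`. -/
abbrev FamilyIndex (n : ℕ) : Type :=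
  Sym2 (Fin (n + 1)) ⊕ Sym2 (Fin n) ⊕ Sym2 (Fin n)

theorem card_familyIndex (n : ℕ) :
    Fintype.card (FamilyIndex n) = (n + 2).choose 2 + 2 * (n + 1).choose 2 := by
  simp only [Fintype.card_sum, Sym2.card, Fintype.card_fin]
  ring

/-- The words between consecutive occurrences of the first letter in a member of one of the three
families: passed separately and concatenated, they give `v v`, or `v v` with a letter of the second
or of the first factor doubled. -/
def gaps {n : ℕ} (v : List A) : FamilyIndex n → List (List A)
  | .inl t => [(v.take t.sup).reverse, (v.drop t.sup ++ v.take t.inf).reverse,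
      (v.drop t.inf).reverse]
  | .inr (.inl t) => [v.reverse, undouble v t.sup t.inf]
  | .inr (.inr t) => [undouble v t.sup t.inf, v.reverse]

/-- The word with first letter `x` and the given `gaps` between the occurrences of `x`. -/
def word {n : ℕ} (x : A) (v : List A) (t : FamilyIndex n) : List A :=
  x :: [x].intercalate (gaps v t)

variable {n : ℕ}

theorem gaps_ne_nil (v : List A) (t : FamilyIndex n) : gaps v t ≠ [] := by
  rcases t with t | t | t <;> exact List.cons_ne_nil _ _

theorem subset_of_mem_gaps {v : List A} {t : FamilyIndex n} {g : List A} (hg : g ∈ gaps v t) :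
    g ⊆ v := by
  have hrev {l : List A} (hl : l ⊆ v) : l.reverse ⊆ v := fun _ hz => hl (List.mem_reverse.1 hz)
  have htake (i : ℕ) : v.take i ⊆ v := List.take_subset i v
  have hdrop (i : ℕ) : v.drop i ⊆ v := List.drop_subset i v
  rcases t with t | t | t <;> simp only [gaps, List.mem_cons, List.not_mem_nil, or_false] at hg
  · rcases hg with rfl | rfl | rfl
    exacts [hrev (htake _), hrev (List.append_subset.2 ⟨hdrop _, htake _⟩), hrev (hdrop _)]
  · rcases hg with rfl | rfl
    exacts [hrev (List.Subset.refl v), subset_undouble v _ _]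
  · rcases hg with rfl | rfl
    exacts [subset_undouble v _ _, hrev (List.Subset.refl v)]

theorem map_word (f : A → A) (x : A) (v : List A) (t : FamilyIndex n) :
    (word x v t).map f = word (f x) (v.map f) t := by
  rcases t with t | t | t <;> simp [word, gaps, List.intercalate_cons_cons, map_undouble]

theorem splitOn_intercalate_gaps [DecidableEq A] {x : A} {v : List A} (hx : x ∉ v)
    (t : FamilyIndex n) : ([x].intercalate (gaps v t)).splitOn x = gaps v t :=
  List.splitOn_intercalate x (fun _ hg hxg => hx (subset_of_mem_gaps hg hxg)) (gaps_ne_nil v t)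

theorem eq_of_sup_eq_of_inf_eq {s t : Sym2 (Fin n)} (hsup : (s.sup : ℕ) = t.sup)
    (hinf : (s.inf : ℕ) = t.inf) : s = t :=
  Sym2.inf_eq_inf_and_sup_eq_sup.1 ⟨Fin.ext hinf, Fin.ext hsup⟩

theorem eq_of_gaps_eq {v v' : List A} (hv : v.Nodup) (hlen : v.length = n) (hlen' : v'.length = n)
    {s t : FamilyIndex n} (h : gaps v s = gaps v' t) : s = t := by
  classical
  have hundouble {v : List A} (hlen : v.length = n) (t : Sym2 (Fin n)) :
      (undouble v t.sup t.inf).length = n + 1 :=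
    (length_undouble t.inf_le_sup (hlen.symm ▸ t.sup.isLt)).trans (by rw [hlen])
  have hinj {s t : Sym2 (Fin n)} (h : undouble v s.sup s.inf = undouble v t.sup t.inf) : s = t :=
    let ⟨hsup, hinf⟩ := (undouble_inj hv s.inf_le_sup (hlen ▸ s.sup.isLt) t.inf_le_sup
      (hlen ▸ t.sup.isLt)).1 h
    eq_of_sup_eq_of_inf_eq hsup hinf
  rcases s with s | s | s <;> rcases t with t | t | t <;>
    simp only [gaps, List.cons.injEq, reduceCtorEq, and_false, and_true] at h
  · have hlen₁ := congrArg List.length h.1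
    have hlen₃ := congrArg List.length h.2.2
    simp only [List.length_reverse, List.length_take, List.length_drop] at hlen₁ hlen₃
    exact congrArg Sum.inl (eq_of_sup_eq_of_inf_eq (by omega) (by omega))
  · obtain rfl := List.reverse_injective h.1
    rw [hinj h.2]
  · have := congrArg List.length h.1
    simp [hundouble hlen', hlen] at this
  · have := congrArg List.length h.1
    simp [hundouble hlen, hlen'] at this
  · obtain rfl := List.reverse_injective h.2
    rw [hinj h.1]

theorem mk_word_injective {x : A} {v : List A} (hv : (x :: v).Nodup) (hlen : v.length = n) :
    Function.Injective fun t : FamilyIndex n => Quotient.mk (equivSetoid A) (word x v t) := by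
  classical
  intro s t hst
  obtain ⟨f, hf⟩ : Equivalent (word x v s) (word x v t) := Quotient.exact hst
  obtain ⟨hx, hv⟩ := List.nodup_cons.1 hv
  rw [map_word, word, word, List.cons.injEq] at hf
  obtain ⟨hfx, hf⟩ := hf
  have hx' : x ∉ v.map f := by
    rw [hfx, List.mem_map_of_injective f.injective]
    exact hx
  rw [← hfx] at hf
  have hgaps := congrArg (List.splitOn x) hf
  rw [splitOn_intercalate_gaps hx, splitOn_intercalate_gaps hx'] at hgaps
  exact (eq_of_gaps_eq hv hlen (by rw [List.length_map, hlen]) hgaps).symm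

theorem exists_take_drop_of_append_eq_append_self {u₁ u₂ u₃ v : List A}
    (h : u₁ ++ (u₂ ++ u₃) = v ++ v) (h₁ : u₁.length ≤ v.length) (h₂ : u₂.length ≤ v.length)
    (h₃ : u₃.length ≤ v.length) :
    ∃ j k, j ≤ k ∧ k ≤ v.length ∧ u₁ = v.take k ∧ u₂ = v.drop k ++ v.take j ∧ u₃ = v.drop j := by
  obtain ⟨r, hr⟩ : u₁ <+: v :=
    List.prefix_of_prefix_length_le ⟨_, h⟩ (List.prefix_append v v) h₁
  obtain ⟨l, hl⟩ : u₃ <:+ v :=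
    List.suffix_of_suffix_length_le ⟨u₁ ++ u₂, by rw [List.append_assoc, h]⟩
      (List.suffix_append v v) h₃
  have hu₂ : u₂ = r ++ l := by
    nth_rewrite 1 [← hr] at h
    rw [← hl, List.append_assoc, List.append_cancel_left_eq, ← List.append_assoc] at h
    exact List.append_cancel_right h
  have hlen := congrArg List.length hr
  rw [hu₂] at h₂
  simp only [List.length_append] at hlen h₂
  refine ⟨l.length, u₁.length, by omega, h₁, ?_, ?_, ?_⟩
  · rw [← hr, List.take_left]
  · nth_rewrite 1 [← hr]
    rw [← hl, List.drop_left, List.take_left, hu₂]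
  · rw [← hl, List.drop_left]

theorem nodup_drop_append_take {v : List A} (hv : v.Nodup) {j k : ℕ} (hjk : j ≤ k) :
    (v.drop k ++ v.take j).Nodup := by
  have hrotate : (v.drop k ++ v.take k).Nodup := by
    rwa [List.perm_append_comm.nodup_iff, List.take_append_drop]
  exact hrotate.sublist ((List.take_sublist_take_left hjk).append_left _)

section Classification

variable [DecidableEq A]

theorem exists_count_eq_succ_of_length_eq {p : List A} {m : ℕ}
    (hlen : p.length = m * p.toFinset.card + 1) (hcount : ∀ z ∈ p, m ≤ p.count z) :
    ∃ b ∈ p, p.count b = m + 1 ∧ ∀ z ∈ p, z ≠ b → p.count z = m := by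
  have hsum : ∑ z ∈ p.toFinset, (p.count z - m) = 1 := by
    have hexcess (z) (hz : z ∈ p.toFinset) : p.count z - m + m = p.count z :=
      Nat.sub_add_cancel (hcount z (List.mem_toFinset.1 hz))
    have hsum := Finset.sum_congr rfl hexcess
    rw [Finset.sum_add_distrib, Finset.sum_const, smul_eq_mul,
      List.sum_toFinset_count_eq_length, hlen, mul_comm] at hsum
    omega
  obtain ⟨b, hb, hb₀⟩ := Finset.exists_ne_zero_of_sum_ne_zero (hsum.trans_ne one_ne_zero)
  rw [← Finset.add_sum_erase _ _ hb] at hsum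
  have hrest : ∑ z ∈ p.toFinset.erase b, (p.count z - m) = 0 := by omega
  refine ⟨b, List.mem_toFinset.1 hb, by omega, fun z hz hzb => ?_⟩
  have hle := hcount z hz
  have hz₀ := Finset.sum_eq_zero_iff.1 hrest z
    (Finset.mem_erase.2 ⟨hzb, List.mem_toFinset.2 hz⟩)
  omega

theorem two_le_count_of_not_clumped {z : A} {p : List A} (h : ¬Clumped z p) : 2 ≤ p.count z := by
  simp only [Clumped, not_forall] at h
  obtain ⟨y, hsub, hne⟩ := h
  simpa [hne] using hsub.count_le z

theorem three_le_count_of_not_clumped {z : A} {l r : List A} (h : ¬Clumped z (l ++ z :: z :: r)) :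
    3 ≤ (l ++ z :: z :: r).count z := by
  by_contra hlt
  simp only [List.count_append, List.count_cons_self] at hlt
  have hl : z ∉ l := List.count_eq_zero.1 (by omega)
  have hr : z ∉ r := List.count_eq_zero.1 (by omega)
  refine h ?_
  simpa [List.replicate] using (clumped_append_replicate hl 2).append_right hr

theorem length_peel_add_count (x : A) (w : List A) :
    (peel x w).length + w.count x = w.length := by
  have hlen := (abaSort_perm (x :: w)).length_eq
  rw [abaSort_cons, List.length_append, List.length_replicate, List.length_cons] at hlen
  omega

theorem Tight.exists_dup_append_self {q r : List A} {b : A} (hq : Tight q) (hqr : Dup q r)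
    (hb : b ∈ q) (hb₃ : q.count b = 3) (hcount : ∀ z ∈ q, z ≠ b → q.count z = 2) :
    ∃ v, v.Nodup ∧ Dup q (v ++ v) := by
  have hr := hqr.tight hq
  obtain ⟨l, c, r, rfl, rfl⟩ := id hqr
  obtain rfl : c = b := by
    by_contra hcb
    have hc := hcount c (by simp) hcb
    have := three_le_count_of_not_clumped fun hclumped =>
      hcb (hq.eq_of_clumped (by simp) hclumped hb).symm
    omega
  obtain ⟨v, hv, hvv⟩ := hr.exists_eq_append_self fun z hz => by
    by_cases hzc : z = c
    · subst hzc
      simp only [List.count_append, List.count_cons_self] at hb₃ ⊢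
      omega
    · have hz₂ := hcount z (hqr.mem_iff.2 hz) hzc
      simpa [List.count_append, List.count_cons, Ne.symm hzc] using hz₂
  exact ⟨v, hv, hvv ▸ hqr⟩

theorem exists_triple_eq_gaps {w₁ w₂ w₃ v : List A} (hv : v.Nodup) (hlen : v.length = n)
    (hn : 2 ≤ n) (h : abaSort w₁ ++ (abaSort w₂ ++ abaSort w₃) = v ++ v) :
    ∃ t : FamilyIndex n, [w₁, w₂, w₃] = gaps v t := by
  have hlength {w : List A} (hw : abaSort w <:+: v ++ v) : (abaSort w).length ≤ v.length := by
    have hw' : (abaSort w).Nodup := (abaSort_perm w).nodup_iff.2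
      (nodup_of_isChain_abaSort ((isChain_append_self hv (hlen ▸ hn)).infix hw))
    refine (hw'.subperm fun z hz => ?_).length_le
    simpa using hw.subset hz
  have h₁ : abaSort w₁ <:+: v ++ v := ⟨[], abaSort w₂ ++ abaSort w₃, by simpa using h⟩
  have h₂ : abaSort w₂ <:+: v ++ v := ⟨abaSort w₁, abaSort w₃, by simpa using h⟩
  have h₃ : abaSort w₃ <:+: v ++ v := ⟨abaSort w₁ ++ abaSort w₂, [], by simpa using h⟩
  obtain ⟨j, k, hjk, hk, e₁, e₂, e₃⟩ :=
    exists_take_drop_of_append_eq_append_self h (hlength h₁) (hlength h₂) (hlength h₃)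
  refine ⟨.inl s(⟨j, by omega⟩, ⟨k, by omega⟩), ?_⟩
  rw [eq_reverse_of_abaSort_eq (hv.sublist (List.take_sublist k v)) e₁,
    eq_reverse_of_abaSort_eq (nodup_drop_append_take hv hjk) e₂,
    eq_reverse_of_abaSort_eq (hv.sublist (List.drop_sublist j v)) e₃]
  simp [gaps, hjk]

theorem exists_pair_eq_gaps {w₁ w₂ v : List A} (hv : v.Nodup) (hlen : v.length = n) (hn : 2 ≤ n)
    (h : Dup (abaSort w₁ ++ abaSort w₂) (v ++ v)) :
    ∃ t : FamilyIndex n, [w₁, w₂] = gaps v t := by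
  obtain ⟨y, z, hhead, hlast, hyz⟩ := exists_head?_ne_getLast? hv (hlen ▸ hn)
  have hundouble {w u : List A} (hw : abaSort w = u) (hu : Dup u v) :
      ∃ t : Sym2 (Fin n), w = undouble v t.sup t.inf := by
    obtain ⟨k, hk, rfl⟩ := dup_iff_exists_take_append_drop.1 hu
    obtain ⟨j, hj, rfl⟩ := exists_eq_undouble_of_abaSort_eq hv hk hw
    exact ⟨s(⟨j, by omega⟩, ⟨k, by omega⟩), by simp [hj]⟩
  obtain ⟨u, hu, huv | hvu⟩ := exists_dup_of_dup_append_self h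
  · obtain ⟨e₁, e₂⟩ := abaSort_append_inj hyz (hu.getLast?_eq.trans hlast) hlast hhead
      hu.sublist.subset huv
    obtain ⟨t, rfl⟩ := hundouble e₁ hu
    exact ⟨.inr (.inr t), by rw [gaps, eq_reverse_of_abaSort_eq hv e₂]⟩
  · obtain ⟨e₁, e₂⟩ := abaSort_append_inj hyz hlast (hu.getLast?_eq.trans hlast)
      (hu.head?_eq.trans hhead) (fun _ hz => hu.mem_iff.1 hz) hvu
    obtain ⟨t, rfl⟩ := hundouble e₂ hu
    exact ⟨.inr (.inl t), by rw [gaps, eq_reverse_of_abaSort_eq hv e₁]⟩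

theorem exists_dup_abaSort_append_of_two_lt_count {w₁ w₂ : List A} {b : A}
    (hb : 2 < (w₁ ++ w₂).count b) : ∃ r, Dup (abaSort w₁ ++ abaSort w₂) r := by
  rcases nodup_or_exists_dup_abaSort w₁ with hnodup₁ | ⟨r, hr⟩
  · rcases nodup_or_exists_dup_abaSort w₂ with hnodup₂ | ⟨r, hr⟩
    · have h₁ := List.nodup_iff_count_le_one.1 hnodup₁ b
      have h₂ := List.nodup_iff_count_le_one.1 hnodup₂ b
      rw [List.count_append] at hb
      omega
    · exact ⟨_, hr.append_left _⟩
  · exact ⟨_, hr.append_right _⟩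

theorem exists_splitOn_eq_gaps_of_count_eq_two {x : A} {w : List A} (hpeel : Tight (peel x w))
    (hx : w.count x = 2) (hcount : ∀ z ∈ w, z ≠ x → w.count z = 2) (hlen : w.length = 2 * n + 2)
    (hn : 2 ≤ n) :
    ∃ v, (x :: v).Nodup ∧ v.length = n ∧ ∃ t : FamilyIndex n, w.splitOn x = gaps v t := by
  obtain ⟨v, hv, hvv⟩ := hpeel.exists_eq_append_self fun z hz => by
    obtain ⟨hzw, hzx⟩ := mem_peel.1 hz
    rw [count_peel hzx, hcount z hzw hzx]
  have hxv : x ∉ v := fun hxv =>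
    (mem_peel.1 (hvv.symm ▸ List.mem_append_left v hxv : x ∈ peel x w)).2 rfl
  have hvlen : v.length = n := by
    have := length_peel_add_count x w
    rw [hvv, List.length_append] at this
    omega
  obtain ⟨w₁, w, rfl, hx₁, hx⟩ := exists_eq_append_cons_of_count_eq_succ hx
  obtain ⟨w₂, w₃, rfl, hx₂, hx₃⟩ := exists_eq_append_cons_of_count_eq_succ (n := 0) hx
  rw [List.count_eq_zero] at hx₃
  rw [peel_append_cons hx₁, peel_append_cons hx₂, peel_of_notMem hx₃] at hvv
  refine ⟨v, List.nodup_cons.2 ⟨hxv, hv⟩, hvlen, ?_⟩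
  rw [List.splitOn_append_cons_self_of_not_mem hx₁, List.splitOn_append_cons_self_of_not_mem hx₂,
    List.splitOn_eq_singleton hx₃]
  exact exists_triple_eq_gaps hv hvlen hn hvv

theorem exists_splitOn_eq_gaps_of_count_eq_one {x b : A} {w : List A} (hpeel : Tight (peel x w))
    (hx : w.count x = 1) (hb : b ≠ x) (hb₃ : w.count b = 3)
    (hcount : ∀ z ∈ w, z ≠ x → z ≠ b → w.count z = 2) (hlen : w.length = 2 * n + 2) (hn : 2 ≤ n) :
    ∃ v, (x :: v).Nodup ∧ v.length = n ∧ ∃ t : FamilyIndex n, w.splitOn x = gaps v t := by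
  obtain ⟨w₁, w₂, rfl, hx₁, hx₂⟩ := exists_eq_append_cons_of_count_eq_succ (n := 0) hx
  rw [List.count_eq_zero] at hx₂
  have hpeel_eq : peel x (w₁ ++ x :: w₂) = abaSort w₁ ++ abaSort w₂ := by
    rw [peel_append_cons hx₁, peel_of_notMem hx₂]
  obtain ⟨r, hr⟩ : ∃ r, Dup (peel x (w₁ ++ x :: w₂)) r := by
    rw [List.count_append, List.count_cons_of_ne hb.symm, ← List.count_append] at hb₃
    exact hpeel_eq ▸ exists_dup_abaSort_append_of_two_lt_count (by omega : 2 < (w₁ ++ w₂).count b)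
  obtain ⟨v, hv, hvv⟩ := hpeel.exists_dup_append_self hr
    (mem_peel.2 ⟨List.count_pos_iff.1 (by omega), hb⟩) (by rw [count_peel hb, hb₃])
    fun z hz hzb => by
      obtain ⟨hzw, hzx⟩ := mem_peel.1 hz
      rw [count_peel hzx, hcount z hzw hzx hzb]
  have hxv : x ∉ v := fun hxv =>
    (mem_peel.1 (hvv.mem_iff.2 (List.mem_append_left v hxv))).2 rfl
  have hvlen : v.length = n := by
    have := length_peel_add_count x (w₁ ++ x :: w₂)
    rw [hvv.length_eq, List.length_append] at this
    omega
  refine ⟨v, List.nodup_cons.2 ⟨hxv, hv⟩, hvlen, ?_⟩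
  rw [List.splitOn_append_cons_self_of_not_mem hx₁, List.splitOn_eq_singleton hx₂]
  exact exists_pair_eq_gaps hv hvlen hn (hpeel_eq ▸ hvv)

theorem Tight.exists_eq_word {p : List A} (h : Tight p) (hn : 2 ≤ n)
    (hcard : p.toFinset.card = n + 1) (hlen : p.length = 2 * (n + 1) + 1) :
    ∃ (x : A) (v : List A) (t : FamilyIndex n),
      (x :: v).Nodup ∧ v.length = n ∧ p = word x v t := by
  cases h with
  | of_subsingleton h =>
    have : p.toFinset.card ≤ 1 := Finset.card_le_one.2 fun y hy z hz =>
      h y (List.mem_toFinset.1 hy) z (List.mem_toFinset.1 hz)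
    omega
  | @cons x w h hpeel =>
    obtain ⟨b, -, hb, hcount⟩ := exists_count_eq_succ_of_length_eq (hcard ▸ hlen)
      fun z hz => two_le_count_of_not_clumped (h z hz)
    have hcount_tail {z : A} (hz : z ≠ x) : (x :: w).count z = w.count z :=
      List.count_cons_of_ne hz.symm
    rw [List.length_cons] at hlen
    obtain ⟨v, hv, hvlen, t, ht⟩ :
        ∃ v, (x :: v).Nodup ∧ v.length = n ∧ ∃ t : FamilyIndex n, w.splitOn x = gaps v t := by
      by_cases hbx : b = x
      · subst hbx
        rw [List.count_cons_self] at hb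
        exact exists_splitOn_eq_gaps_of_count_eq_two hpeel (by omega)
          (fun z hz hzb => hcount_tail hzb ▸ hcount z (List.mem_cons_of_mem b hz) hzb)
          (by omega) hn
      · have hx := hcount x List.mem_cons_self (Ne.symm hbx)
        rw [List.count_cons_self] at hx
        exact exists_splitOn_eq_gaps_of_count_eq_one hpeel (by omega) hbx (hcount_tail hbx ▸ hb)
          (fun z hz hzx hzb => hcount_tail hzx ▸ hcount z (List.mem_cons_of_mem x hz) hzb)
          (by omega) hn
    exact ⟨x, v, t, hv, hvlen, by rw [word, ← ht, List.intercalate_splitOn]⟩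

end Classification

/-! ### The unsorted classes -/

section Converse

variable [DecidableEq A]

theorem not_isSorted_iterate_abaSort_append {k : ℕ} {B T C E : List A} (hT : T.length = k + 1)
    (hnodup : (B ++ (T ++ (C ++ E))).Nodup) (hE : E ≠ []) (hC : k = 0 → C ≠ []) :
    ¬IsSorted (abaSort^[k] (B ++ (T ++ (C ++ (T ++ E))))) := by
  induction k generalizing B T C E with
  | zero =>
    intro hsorted
    obtain ⟨y, rfl⟩ := List.length_eq_one_iff.1 hT
    obtain ⟨d, C, rfl⟩ := List.exists_cons_of_ne_nil (hC rfl)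
    obtain rfl : d = y := isSorted_iff_forall_clumped.1 hsorted y d
      (List.Sublist.trans (by simp) (List.sublist_append_right _ _))
    simp [List.nodup_append] at hnodup
  | succ k ih =>
    obtain ⟨y, t, rfl⟩ := List.exists_cons_of_length_eq_add_one hT
    have hu : (B ++ y :: (t ++ C)).Nodup := hnodup.sublist (by simp)
    have hv : (B ++ y :: (t ++ E)).Nodup := hnodup.sublist (by simp)
    have hpass := abaSort_append_cons_append_cons hu hv
    have hdup : Dup (C.reverse ++ t.reverse ++ (E.reverse ++ t.reverse) ++ y :: y :: B.reverse)
        (C.reverse ++ (t.reverse ++ (E.reverse ++ (t.reverse ++ y :: B.reverse)))) :=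
      ⟨C.reverse ++ t.reverse ++ (E.reverse ++ t.reverse), y, B.reverse, rfl, by simp⟩
    rw [Function.iterate_succ_apply]
    simp only [List.cons_append, List.append_assoc, List.reverse_append] at hpass hdup ⊢
    rw [hpass]
    refine (hdup.iterate_abaSort k).not_isSorted (ih (by simpa using hT) ?_ (by simp)
      fun _ => by simpa using hE)
    refine (List.Perm.nodup_iff (List.perm_iff_count.2 fun a => ?_)).1 hnodup
    simp only [List.count_append, List.count_cons, List.count_reverse]
    omega

theorem not_isSorted_iterate_abaSort_append_self {x : A} {v : List A} (hv : (x :: v).Nodup)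
    (hlen : v.length = n + 1) (hn : n ≠ 0) :
    ¬IsSorted (abaSort^[n] (v ++ (v ++ [x]))) :=
  not_isSorted_iterate_abaSort_append (B := []) (C := []) hlen
    (List.perm_append_comm (l₁ := [x]).nodup_iff.1 hv) (List.cons_ne_nil x []) fun h => absurd h hn

theorem abaSort_word {x : A} {v : List A} (hx : x ∉ v) (t : FamilyIndex n) :
    abaSort (word x v t) =
      (gaps v t).flatMap abaSort ++ List.replicate (gaps v t).length x := by
  rw [word, abaSort_cons, peel, ← length_splitOn, splitOn_intercalate_gaps hx]

theorem flatMap_abaSort_gaps_inl {v : List A} (hv : v.Nodup) (t : Sym2 (Fin (n + 1))) :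
    (gaps v (.inl t : FamilyIndex n)).flatMap abaSort = v ++ v := by
  simp only [gaps, List.flatMap_cons, List.flatMap_nil, List.append_nil]
  rw [abaSort_reverse (hv.sublist (List.take_sublist _ v)),
    abaSort_reverse (nodup_drop_append_take hv t.inf_le_sup),
    abaSort_reverse (hv.sublist (List.drop_sublist _ v)), List.append_assoc,
    List.take_append_drop, ← List.append_assoc, List.take_append_drop]

theorem dup_flatMap_abaSort_gaps_inr {v : List A} (hv : v.Nodup) (hlen : v.length = n)
    (t : Sym2 (Fin n) ⊕ Sym2 (Fin n)) :
    Dup ((gaps v (.inr t : FamilyIndex n)).flatMap abaSort) (v ++ v) := by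
  have hundouble (t : Sym2 (Fin n)) : Dup (abaSort (undouble v t.sup t.inf)) v := by
    have hk : (t.sup : ℕ) < v.length := hlen ▸ t.sup.isLt
    exact dup_iff_exists_take_append_drop.2 ⟨_, hk, abaSort_undouble hv t.inf_le_sup hk⟩
  rcases t with t | t <;>
    simp only [gaps, List.flatMap_cons, List.flatMap_nil, List.append_nil, abaSort_reverse hv]
  · exact (hundouble t).append_left v
  · exact (hundouble t).append_right v

theorem exists_dup_dup_abaSort_word {x : A} {v : List A} (hv : (x :: v).Nodup)
    (hlen : v.length = n) (t : FamilyIndex n) :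
    ∃ q, Dup (abaSort (word x v t)) q ∧ Dup q (v ++ (v ++ [x])) := by
  obtain ⟨hx, hv⟩ := List.nodup_cons.1 hv
  have hdup : Dup (v ++ v ++ [x, x]) (v ++ (v ++ [x])) := ⟨v ++ v, x, [], rfl, by simp⟩
  refine ⟨v ++ v ++ [x, x], ?_, hdup⟩
  rw [abaSort_word hx]
  rcases t with t | t
  · rw [flatMap_abaSort_gaps_inl hv]
    exact ⟨v ++ v, x, [x], rfl, rfl⟩
  · have hlength : (gaps v (.inr t : FamilyIndex n)).length = 2 := by rcases t with t | t <;> rfl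
    rw [hlength]
    exact (dup_flatMap_abaSort_gaps_inr hv hlen t).append_right [x, x]

theorem numLetters_eq_card_toFinset (p : List A) : numLetters p = p.toFinset.card := by
  rw [numLetters, ← List.coe_toFinset, Set.ncard_coe_finset]

end Converse

theorem numLetters_word {x : A} {v : List A} (hv : (x :: v).Nodup) (hlen : v.length = n)
    (t : FamilyIndex n) : numLetters (word x v t) = n + 1 := by
  classical
  obtain ⟨q, hwq, hq⟩ := exists_dup_dup_abaSort_word hv hlen t
  have hletters : {z | z ∈ word x v t} = {z | z ∈ x :: v} := by
    ext z
    rw [Set.mem_ofPred_eq, ← mem_abaSort, hwq.mem_iff, hq.mem_iff]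
    simp [or_comm, or_left_comm]
  rw [numLetters, hletters, ← numLetters, numLetters_eq_card_toFinset,
    List.toFinset_card_of_nodup hv, List.length_cons, hlen]

theorem length_word {x : A} {v : List A} (hv : (x :: v).Nodup) (hlen : v.length = n)
    (t : FamilyIndex n) : (word x v t).length = 2 * (n + 1) + 1 := by
  classical
  obtain ⟨q, hwq, hq⟩ := exists_dup_dup_abaSort_word hv hlen t
  rw [← (abaSort_perm _).length_eq, hwq.length_eq, hq.length_eq, List.length_append,
    List.length_append, List.length_singleton, hlen]
  omega

theorem not_isSorted_iterate_abaSort_word [DecidableEq A] {x : A} {v : List A}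
    (hv : (x :: v).Nodup) (hlen : v.length = n) (hn : 2 ≤ n) (t : FamilyIndex n) :
    ¬IsSorted (abaSort^[n] (word x v t)) := by
  obtain ⟨k, rfl⟩ := Nat.exists_eq_add_of_le' (Nat.one_le_of_lt hn)
  obtain ⟨q, hwq, hq⟩ := exists_dup_dup_abaSort_word hv hlen t
  rw [Function.iterate_succ_apply]
  exact (hwq.iterate_abaSort k).not_isSorted ((hq.iterate_abaSort k).not_isSorted
    (not_isSorted_iterate_abaSort_append_self hv hlen (by omega)))

theorem exists_equivalent_word [DecidableEq A] {p : List A} (hn : 2 ≤ n)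
    (hletters : numLetters p = n + 1) (hlen : p.length = 2 * (n + 1) + 1)
    (hp : ¬IsSorted (abaSort^[n] p)) {x : A} {v : List A} (hv : (x :: v).Nodup)
    (hvlen : v.length = n) :
    ∃ t : FamilyIndex n, Equivalent (word x v t) p := by
  rw [numLetters_eq_card_toFinset] at hletters
  have htight : Tight p := by
    have := tight_filter_of_not_isSorted hletters
      (fun z hz => clumped_of_notMem (mt List.mem_toFinset.2 hz)) hp
    rwa [List.filter_eq_self.2 (by simp)] at this
  obtain ⟨y, u, t, hu, hulen, rfl⟩ := htight.exists_eq_word hn hletters hlen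
  obtain ⟨f, hf⟩ := exists_perm_map_eq hv hu (by simp only [List.length_cons, hvlen, hulen])
  rw [List.map_cons, List.cons.injEq] at hf
  exact ⟨t, f, by rw [map_word, hf.1, hf.2]⟩

theorem image_mk_unsorted_eq_range [DecidableEq A] (hn : 2 ≤ n) {x : A} {v : List A}
    (hv : (x :: v).Nodup) (hvlen : v.length = n) :
    Quotient.mk (equivSetoid A) '' {p | numLetters p = n + 1 ∧ p.length = 2 * (n + 1) + 1 ∧
        ¬IsSorted (abaSort^[n] p)} =
      Set.range fun t : FamilyIndex n => Quotient.mk (equivSetoid A) (word x v t) := by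
  ext c
  constructor
  · rintro ⟨p, ⟨hletters, hlen, hp⟩, rfl⟩
    obtain ⟨t, ht⟩ := exists_equivalent_word hn hletters hlen hp hv hvlen
    exact ⟨t, Quotient.sound ht⟩
  · rintro ⟨t, rfl⟩
    exact ⟨word x v t, ⟨numLetters_word hv hvlen t, length_word hv hvlen t,
      not_isSorted_iterate_abaSort_word hv hvlen hn t⟩, rfl⟩

theorem exists_nodup_length_eq (h : (n : ℕ∞) ≤ ENat.card A) :
    ∃ l : List A, l.Nodup ∧ l.length = n := by
  rw [← Set.encard_univ] at h
  obtain ⟨s, -, hs⟩ := Set.exists_subset_encard_eq h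
  have hfin : s.Finite := Set.finite_of_encard_eq_coe hs
  refine ⟨hfin.toFinset.toList, Finset.nodup_toList _, ?_⟩
  rw [Finset.length_toList, ← Nat.cast_inj (R := ℕ∞), ← hfin.encard_eq_coe_toFinset_card, hs]

end StackSort

theorem theorem2 {A : Type*} (N : ℕ) (hN : 3 ≤ N) (hA : (N : ℕ∞) ≤ ENat.card A)
    (a b : A) (hab : a ≠ b) :
    (Quotient.mk (StackSort.equivSetoid A) ''
        {p : List A | StackSort.numLetters p = N ∧ p.length = 2 * N + 1 ∧
          ¬ StackSort.IsSorted ((StackSort.phi [a, b, a])^[N - 1] p)}).encard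
      = (((N + 1).choose 2 + 2 * N.choose 2 : ℕ) : ℕ∞) := by
  classical
  open StackSort in
  obtain ⟨n, rfl⟩ := Nat.exists_eq_add_of_le' (Nat.one_le_of_lt hN)
  obtain ⟨l, hl, hlen⟩ := exists_nodup_length_eq hA
  obtain ⟨x, v, rfl⟩ := List.exists_cons_of_length_eq_add_one hlen
  have hvlen : v.length = n := Nat.succ_injective hlen
  rw [Nat.add_sub_cancel, phi_aba_eq_abaSort hab, image_mk_unsorted_eq_range (by omega) hl hvlen,
    ← Set.image_univ, (mk_word_injective hl hvlen).encard_image, Set.encard_univ,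
    ENat.card_eq_coe_fintype_card, card_familyIndex]
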